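/- Let $n\in\mathbb{N}$ and let $P\subset\mathbb{R}^n$ be a convex polytope, i.e. a bounded intersection of finitely many closed half-spaces with non-empty interior. Call $P$ acute if for any two distinct facets ($(n-1)$-dimensional faces) $F,G$ of $P$ with $F\cap G\neq\emptyset$ and $\dim(F\cap G)=n-2$, with inward unit normal vectors $q_F,q_G$, the dihedral angle $\pi-\angle(q_F,q_G)$ lies in $(0,\frac{\pi}{2})$. A closed billiard trajectory in $P$ is a tuple $p=(p_1,\dots,p_m)$, $m\ge 2$, of pairwise distinct points (the bouncing points) of the boundary $\partial P$ such that for every $j$ (indices modulo $m$) there is a supporting hyperplane $H_j$ of $P$ through $p_j$ such that $p_j$ minimizes $\|x-p_{j-1}\|+\|p_{j+1}-x\|$ over all $x\in H_j$, and such that $p_j$ does not lie on the line segment connecting $p_{j-1}$ and $p_{j+1}$. Its length is $\sum_{j=1}^m\|p_{j+1}-p_j\|$. It is length minimizing if no closed billiard trajectory in $P$ (with any number of bouncing points) has smaller length. Theorem. Let $P\subset\mathbb{R}^n$ be an acute convex polytope and let $p=(p_1,\dots,p_m)$ be a length minimizing closed billiard trajectory in $P$. Then 1. $p$ is maximally spanning,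 i.e. $\dim(\operatorname{conv}\{p_1,\dots,p_m\})=m-1$; 2. $p$ is regular, i.e. through every $p_j$ there passes exactly one supporting hyperplane of $P$; 3. $m=n+1$. -/

import Mathlib

namespace Billiard

noncomputable section

/-- The dimension of a (nonempty) set: the dimension of its affine hull. -/
def affineDim {n : ℕ} (S : Set (EuclideanSpace ℝ (Fin n))) : ℕ :=
  Module.finrank ℝ (vectorSpan ℝ S)

/-- Closed half-spaces `{x | ⟪u, x⟫ ≤ c}` with `u ≠ 0`. -/
def IsClosedHalfSpace {n : ℕ} (H : Set (EuclideanSpace ℝ (Fin n))) : Prop :=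
  ∃ (u : EuclideanSpace ℝ (Fin n)) (c : ℝ), u ≠ 0 ∧ H = {x | inner ℝ u x ≤ c}

/-- Full-dimensional convex polytopes: bounded intersections of finitely many closed
half-spaces, with nonempty interior. -/
def IsConvexPolytope {n : ℕ} (P : Set (EuclideanSpace ℝ (Fin n))) : Prop :=
  (∃ 𝓗 : Set (Set (EuclideanSpace ℝ (Fin n))),
      𝓗.Finite ∧ (∀ H ∈ 𝓗, IsClosedHalfSpace H) ∧ P = ⋂₀ 𝓗) ∧
    Bornology.IsBounded P ∧ (interior P).Nonempty

/-- `H` is a `T`-supporting hyperplane: a hyperplane that meets `T` and has `T` on one side. -/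
def IsSupportingHyperplane {n : ℕ} (T H : Set (EuclideanSpace ℝ (Fin n))) : Prop :=
  ∃ (u : EuclideanSpace ℝ (Fin n)) (c : ℝ), u ≠ 0 ∧ H = {x | inner ℝ u x = c} ∧
    (∀ x ∈ T, inner ℝ u x ≤ c) ∧ (T ∩ H).Nonempty

/-- Facets of `P`: the faces `P ∩ H`, with `H` a `P`-supporting hyperplane, of dimension
`n - 1`. -/
def IsFacet {n : ℕ} (P F : Set (EuclideanSpace ℝ (Fin n))) : Prop :=
  (∃ H, IsSupportingHyperplane P H ∧ F = P ∩ H) ∧ affineDim F + 1 = n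

/-- `q` is an inward unit normal vector to the facet `F` of `P`. (Taking `y ∈ F` and exchanging
`x` and `y` shows that `q` is orthogonal to `F`.) -/
def IsInwardUnitNormal {n : ℕ} (P F : Set (EuclideanSpace ℝ (Fin n)))
    (q : EuclideanSpace ℝ (Fin n)) : Prop :=
  ‖q‖ = 1 ∧ ∀ x ∈ F, ∀ y ∈ P, 0 ≤ inner ℝ q (y - x)

/-- The dihedral angle between two facets with inward unit normal vectors `q` and `q'`. -/
def dihedralAngle {n : ℕ} (q q' : EuclideanSpace ℝ (Fin n)) : ℝ :=
  Real.pi - InnerProductGeometry.angle q q'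

/-- `P` is acute: for any two distinct facets whose intersection is nonempty of dimension
`n - 2`, the dihedral angle between them lies in `(0, π / 2)`. -/
def IsAcute {n : ℕ} (P : Set (EuclideanSpace ℝ (Fin n))) : Prop :=
  ∀ F G : Set (EuclideanSpace ℝ (Fin n)), IsFacet P F → IsFacet P G → F ≠ G →
    (F ∩ G).Nonempty → affineDim (F ∩ G) + 2 = n →
    ∀ q q' : EuclideanSpace ℝ (Fin n), IsInwardUnitNormal P F q → IsInwardUnitNormal P G q' →
      dihedralAngle q q' ∈ Set.Ioo 0 (Real.pi / 2)

/-- The index following `j`, cyclically: `j + 1` modulo `m`. -/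
def next {m : ℕ} (j : Fin m) : Fin m := finRotate m j

/-- The index preceding `j`, cyclically: `j - 1` modulo `m`. -/
def prev {m : ℕ} (j : Fin m) : Fin m := (finRotate m).symm j

/-- `(p₁, …, pₘ)`, `m ≥ 2`, is a closed billiard trajectory in `T`: its vertices are pairwise
distinct points of the boundary of `T`, for every `j` there is a `T`-supporting hyperplane `H`
through `pⱼ` such that `pⱼ` minimizes `‖x - pⱼ₋₁‖ + ‖pⱼ₊₁ - x‖` over `x ∈ H`, and `pⱼ` does
not lie on the segment from `pⱼ₋₁` to `pⱼ₊₁`. -/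
def IsClosedBilliardTrajectory {n m : ℕ} (T : Set (EuclideanSpace ℝ (Fin n)))
    (p : Fin m → EuclideanSpace ℝ (Fin n)) : Prop :=
  2 ≤ m ∧ Function.Injective p ∧ (∀ j, p j ∈ frontier T) ∧
    (∀ j, ∃ H, IsSupportingHyperplane T H ∧ p j ∈ H ∧
      ∀ x ∈ H, ‖p j - p (prev j)‖ + ‖p (next j) - p j‖ ≤ ‖x - p (prev j)‖ + ‖p (next j) - x‖) ∧
    ∀ j, p j ∉ segment ℝ (p (prev j)) (p (next j))

/-- The length of the closed polygonal line with vertices `p₁, …, pₘ`. -/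
def length {n m : ℕ} (p : Fin m → EuclideanSpace ℝ (Fin n)) : ℝ :=
  ∑ j, ‖p (next j) - p j‖

/-- Closed billiard trajectories in `T` of minimal length among all closed billiard trajectories
in `T`, with any number of bouncing points. -/
def IsLengthMinimizing {n m : ℕ} (T : Set (EuclideanSpace ℝ (Fin n)))
    (p : Fin m → EuclideanSpace ℝ (Fin n)) : Prop :=
  IsClosedBilliardTrajectory T p ∧
    ∀ (k : ℕ) (r : Fin k → EuclideanSpace ℝ (Fin n)),
      IsClosedBilliardTrajectory T r → length p ≤ length r

/-- Smooth boundary points: exactly one supporting hyperplane passes through the point. -/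
def IsSmoothBoundaryPoint {n : ℕ} (T : Set (EuclideanSpace ℝ (Fin n)))
    (x : EuclideanSpace ℝ (Fin n)) : Prop :=
  x ∈ frontier T ∧ ∃! H : Set (EuclideanSpace ℝ (Fin n)), IsSupportingHyperplane T H ∧ x ∈ H

/-- All bouncing points are smooth boundary points of `T`. -/
def IsRegular {n m : ℕ} (T : Set (EuclideanSpace ℝ (Fin n)))
    (p : Fin m → EuclideanSpace ℝ (Fin n)) : Prop :=
  ∀ j, IsSmoothBoundaryPoint T (p j)

/-- The convex hull of the `m` bouncing points has dimension `m - 1`. -/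
def IsMaximallySpanning {n m : ℕ} (p : Fin m → EuclideanSpace ℝ (Fin n)) : Prop :=
  affineDim (convexHull ℝ (Set.range p)) + 1 = m

end

end Billiard

/-!
An acute polytope `P` is a simplex. Indeed, the normals of any two of its facets form an obtuse
angle, whether the facets are adjacent or not (`IsAcute.pairwise_inner_neg`), and vectors with
pairwise negative inner products satisfy, up to a factor, at most one linear relation, which has
positive coefficients throughout (`coeff_nonpos_of_sum_smul_eq_zero`). Boundedness of `P` provides
such a relation, and so there are `n + 1` facets (`IsAcute.exists_isObtuseSimplex`).

The shortest closed billiard trajectories in `P` are no longer than any closed polygon with a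
vertex on or beyond every facet hyperplane (`IsObtuseSimplex.exists_trajectory_length_le`). A
shortest such polygon with a given number of vertices exists by compactness, and if none of its
vertices can be omitted, stationarity of the length says that the bends at its vertices, which
sum to zero, are nonnegative combinations of the normals of those facets that the vertex alone
reaches. By uniqueness of the relation every normal occurs, which places the polygon inside `P` and
makes it a billiard trajectory.

Now let `p` be a shortest trajectory. By the same uniqueness it meets all facets. If one of
its vertices lay on two facets, it could be split in two neighbouring vertices so that the new
polygon still meets all facets but is shorter (`exists_splitting`); this is where the obtuse
angles between normals enter once more. So every vertex lies on exactly one facet, which is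
regularity. If every facet met another vertex than a given one, that vertex could be omitted, and
the polygon would become shorter; thus vertices and facets correspond bijectively and there are
`n + 1` vertices. Finally, the bends are multiples of all the facet normals and lie in the
direction space of the affine span of the vertices, which is therefore the whole space.
-/

namespace Billiard

open Filter Topology

/-! ### Vectors with pairwise negative inner products -/

section LinearAlgebra

variable {F ι : Type*} [NormedAddCommGroup F] [InnerProductSpace ℝ F]

/-- A linear relation between vectors with pairwise negative inner products has no mixed signs:
both sides of the equation of its positive part with its negative part are zero, as their inner
product is at most zero, and the inner product of such a vanishing sum with a further vector of
the family can vanish only if all coefficients do. -/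
theorem coeff_nonpos_of_sum_smul_eq_zero [Fintype ι] {a : ι → F}
    (ha : Pairwise fun i j => inner ℝ (a i) (a j) < 0) {c : ι → ℝ}
    (hc : ∑ i, c i • a i = 0) {i₀ : ι} (h₀ : c i₀ ≤ 0) (i : ι) : c i ≤ 0 := by
  -- the positive part of the relation, which equals its negative part
  set v : F := ∑ i, max (c i) 0 • a i with hv
  have hvw : v = ∑ i, max (-c i) 0 • a i := by
    rw [← sub_eq_zero, hv, ← Finset.sum_sub_distrib, ← hc]
    refine Finset.sum_congr rfl fun i _ => ?_
    rw [← sub_smul]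
    congr 1
    rcases le_total (c i) 0 with h | h
    · rw [max_eq_right h, max_eq_left (by linarith)]; ring
    · rw [max_eq_left h, max_eq_right (by linarith)]; ring
  have hv0 : v = 0 := by
    have h : inner ℝ v v ≤ 0 := by
      nth_rewrite 2 [hvw]
      rw [hv, sum_inner]
      refine Finset.sum_nonpos fun i _ => ?_
      rw [inner_sum]
      refine Finset.sum_nonpos fun j _ => ?_
      rw [real_inner_smul_left, real_inner_smul_right]
      rcases eq_or_ne i j with rfl | hij
      · rcases le_total (c i) 0 with h | h
        · rw [max_eq_right h]; simp
        · rw [max_eq_right (a := -c i) (by linarith)]; simp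
      · exact mul_nonpos_of_nonneg_of_nonpos (le_max_right _ _)
          (mul_nonpos_of_nonneg_of_nonpos (le_max_right _ _) (ha hij).le)
    exact inner_self_eq_zero.mp (le_antisymm h real_inner_self_nonneg)
  have hsum : ∑ i, -(max (c i) 0 * inner ℝ (a i₀) (a i)) = 0 := by
    have : inner ℝ (a i₀) v = 0 := by rw [hv0, inner_zero_right]
    rw [hv, inner_sum] at this
    simp only [real_inner_smul_right] at this
    rw [Finset.sum_neg_distrib, this, neg_zero]
  rcases eq_or_ne i₀ i with rfl | hi
  · exact h₀
  rw [Finset.sum_eq_zero_iff_of_nonneg] at hsum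
  · have h := hsum i (Finset.mem_univ _)
    have hn := ha hi
    have : max (c i) 0 = 0 := by
      rcases mul_eq_zero.mp (neg_eq_zero.mp h) with h | h
      · exact h
      · exact absurd h hn.ne
    exact max_eq_right_iff.mp this
  · intro j _
    rcases eq_or_ne i₀ j with rfl | hj
    · rw [max_eq_right h₀]; simp
    · have := mul_nonpos_of_nonneg_of_nonpos (le_max_right (c j) 0) (ha hj).le
      linarith

theorem coeff_eq_zero_of_sum_smul_eq_zero [Fintype ι] {a : ι → F}
    (ha : Pairwise fun i j => inner ℝ (a i) (a j) < 0) {c : ι → ℝ}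
    (hc : ∑ i, c i • a i = 0) {i₀ : ι} (h₀ : c i₀ = 0) (i : ι) : c i = 0 := by
  refine le_antisymm (coeff_nonpos_of_sum_smul_eq_zero ha hc h₀.le i) ?_
  have hc' : ∑ i, (-c i) • a i = 0 := by
    simp only [neg_smul, Finset.sum_neg_distrib, hc, neg_zero]
  have := coeff_nonpos_of_sum_smul_eq_zero ha hc' (i₀ := i₀) (by simp [h₀]) i
  linarith

theorem linearIndepOn_of_pairwise_inner_neg [Fintype ι] {a : ι → F}
    (ha : Pairwise fun i j => inner ℝ (a i) (a j) < 0) {D : Finset ι} {i₀ : ι} (h₀ : i₀ ∉ D) :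
    LinearIndepOn ℝ a (D : Set ι) := by
  classical
  rw [linearIndepOn_finset_iff]
  intro c hc i hi
  have hsum : ∑ i, (if i ∈ D then c i else 0) • a i = 0 := by
    simpa [ite_smul, Finset.sum_ite_mem] using hc
  have := coeff_eq_zero_of_sum_smul_eq_zero ha hsum (i₀ := i₀) (by simp [h₀]) i
  simpa [hi] using this

variable [FiniteDimensional ℝ F]

theorem exists_inner_eq_of_linearIndepOn {a : ι → F} {D : Set ι} (hD : LinearIndepOn ℝ a D)
    (g : ι → ℝ) : ∃ d, ∀ i ∈ D, inner ℝ (a i) d = g i := by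
  obtain ⟨f, hf⟩ := LinearMap.exists_extend
    ((Module.Basis.span hD).constr ℝ (fun i : D => g i))
  refine ⟨(InnerProductSpace.toDual ℝ F).symm f.toContinuousLinearMap, fun i hi => ?_⟩
  rw [real_inner_comm, InnerProductSpace.toDual_symm_apply]
  have h := congrArg (fun φ => φ (Module.Basis.span hD ⟨i, hi⟩)) hf
  simp only [Module.Basis.constr_basis] at h
  have hb : ((Module.Basis.span hD ⟨i, hi⟩ : Submodule.span ℝ (Set.range fun i : D => a i)) : F)
      = a i := congrArg Subtype.val (Module.Basis.span_apply hD ⟨i, hi⟩)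
  rw [← hb]
  simpa using h

/-- Farkas' lemma for a linearly independent family, where it follows from the existence of dual
vectors. -/
theorem exists_nonneg_combination [Fintype ι] {a : ι → F} {D : Finset ι}
    (hD : LinearIndepOn ℝ a (D : Set ι)) {v : F}
    (hv : ∀ d, (∀ i ∈ D, 0 ≤ inner ℝ (a i) d) → 0 ≤ inner ℝ v d) :
    ∃ c : ι → ℝ, (∀ i, 0 ≤ c i) ∧ (∀ i ∉ D, c i = 0) ∧ v = ∑ i, c i • a i := by
  classical
  -- `v` lies in the span, since its component orthogonal to the span can be tested with `hv`
  set W := Submodule.span ℝ (a '' (D : Set ι)) with hW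
  have hvW : v ∈ W := by
    have horth : v - W.starProjection v ∈ Wᗮ := W.sub_starProjection_mem_orthogonal v
    have h := hv (-(v - W.starProjection v)) fun i hi => by
      rw [inner_neg_right, (Submodule.mem_orthogonal _ _).mp horth (a i)
        (Submodule.subset_span ⟨i, hi, rfl⟩), neg_zero]
    have h2 : inner ℝ (W.starProjection v) (v - W.starProjection v) = 0 :=
      (Submodule.mem_orthogonal _ _).mp horth _ (W.starProjection_apply_mem v)
    have h3 : inner ℝ (v - W.starProjection v) (v - W.starProjection v) ≤ 0 := by
      rw [inner_sub_left, h2]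
      rw [inner_neg_right] at h
      linarith
    have h4 := inner_self_eq_zero.mp (le_antisymm h3 real_inner_self_nonneg)
    rw [sub_eq_zero.mp h4]
    exact W.starProjection_apply_mem v
  obtain ⟨c, hc⟩ : ∃ c : ι → ℝ, ∑ i ∈ D, c i • a i = v := by
    obtain ⟨c, hc⟩ := (Submodule.mem_span_image_finset_iff_exists_fun ℝ).mp hvW
    refine ⟨fun i => if h : i ∈ D then c ⟨i, h⟩ else 0, ?_⟩
    rw [← hc, ← Finset.sum_coe_sort]
    exact Finset.sum_congr rfl fun i _ => by simp
  refine ⟨fun i => if i ∈ D then c i else 0, fun i => ?_, fun i hi => by simp [hi], ?_⟩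
  · by_cases hi : i ∈ D
    · simp only [hi, if_true]
      obtain ⟨d, hd⟩ := exists_inner_eq_of_linearIndepOn hD (fun k => if k = i then 1 else 0)
      have h := hv d fun k hk => by
        rw [hd k hk]; split_ifs <;> norm_num
      rw [← hc, sum_inner] at h
      rw [Finset.sum_congr rfl (g := fun k => if k = i then c k else 0) fun k hk => by
        rw [real_inner_smul_left, hd k hk]; simp] at h
      simpa [hi] using h
    · simp [hi]
  · rw [← hc]
    simp [ite_smul, Finset.sum_ite_mem]

end LinearAlgebra

/-! ### Facet normals of acute polytopes -/

section Normals

/-- Among finitely many constraints `C i` that force points of `V` into `P` there are some that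
still do so and none of which can be omitted. Taking for `V` a hyperplane yields the constraints
that cut out a facet inside its own hyperplane. -/
theorem exists_irredundant_subfamily {X κ : Type*} {V P : Set X} {C : κ → Set X} (s : Finset κ)
    (hs : ∀ x ∈ V, (∀ i ∈ s, x ∈ C i) → x ∈ P) :
    ∃ t ⊆ s, (∀ x ∈ V, (∀ i ∈ t, x ∈ C i) → x ∈ P) ∧
      ∀ i ∈ t, ∃ y ∈ V, y ∉ P ∧ y ∉ C i ∧ ∀ k ∈ t, k ≠ i → y ∈ C k := by
  classical
  induction s using Finset.strongInduction with
  | H s ih =>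
    by_cases h : ∃ i ∈ s, ∀ x ∈ V, (∀ k ∈ s.erase i, x ∈ C k) → x ∈ P
    · obtain ⟨i, hi, h⟩ := h
      obtain ⟨t, hts, ht⟩ := ih _ (Finset.erase_ssubset hi) h
      exact ⟨t, hts.trans (Finset.erase_subset _ _), ht⟩
    · push Not at h
      refine ⟨s, subset_rfl, hs, fun i hi => ?_⟩
      obtain ⟨y, hyV, hy, hyP⟩ := h i hi
      have hy' : ∀ k ∈ s, k ≠ i → y ∈ C k := fun k hk hki => hy k (Finset.mem_erase.mpr ⟨hki, hk⟩)
      refine ⟨y, hyV, hyP, fun hyi => hyP (hs y hyV fun k hk => ?_), hy'⟩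
      rcases eq_or_ne k i with rfl | hki
      exacts [hyi, hy' k hk hki]

section InnerProduct

variable {F : Type*} [NormedAddCommGroup F] [InnerProductSpace ℝ F]

/-- The segment from `o` to `z` crosses the hyperplane `⟪a, x⟫ = β` in a point that satisfies
strictly every inequality strict at `o` and valid at `z`, and every equation valid at both. -/
theorem exists_mem_hyperplane_of_crossing {a o z : F} {β : ℝ} (ho : inner ℝ a o < β)
    (hz : β < inner ℝ a z) :
    ∃ x, inner ℝ a x = β ∧
      (∀ c γ, inner ℝ c o < γ → inner ℝ c z ≤ γ → inner ℝ c x < γ) ∧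
      ∀ c γ, inner ℝ c o = γ → inner ℝ c z = γ → inner ℝ c x = γ := by
  set t := (β - inner ℝ a o) / (inner ℝ a z - inner ℝ a o) with ht
  have h1 : 0 < inner ℝ a z - inner ℝ a o := by linarith
  have ht0 : 0 < t := div_pos (by linarith) h1
  have ht1 : t < 1 := (div_lt_one h1).mpr (by linarith)
  have key : ∀ c, inner ℝ c (o + t • (z - o)) = inner ℝ c o + t * (inner ℝ c z - inner ℝ c o) := by
    intro c
    rw [inner_add_right, real_inner_smul_right, inner_sub_right]
  refine ⟨o + t • (z - o), ?_, fun c γ h2 h3 => ?_, fun c γ h2 h3 => ?_⟩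
  · rw [key, ht]; field_simp; ring
  · rw [key]; nlinarith
  · rw [key, h2, h3]; ring

theorem eventually_inner_add_smul_lt {a x : F} {β : ℝ} (h : inner ℝ a x < β) (d : F) :
    ∀ᶠ ε in 𝓝 (0 : ℝ), inner ℝ a (x + ε • d) < β := by
  have hc : Continuous fun ε : ℝ => inner ℝ a (x + ε • d) := by fun_prop
  exact (hc.tendsto 0).eventually_lt_const (by simpa using h)

theorem vectorSpan_eq_of_directions {S : Set F} {W : Submodule ℝ F} {x : F} (hx : x ∈ S)
    (h₁ : ∀ y ∈ S, y - x ∈ W) (h₂ : ∀ d ∈ W, ∃ ε : ℝ, ε ≠ 0 ∧ x + ε • d ∈ S) :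
    vectorSpan ℝ S = W := by
  apply le_antisymm
  · rw [vectorSpan_eq_span_vsub_set_right ℝ hx, Submodule.span_le]
    rintro _ ⟨y, hy, rfl⟩
    exact h₁ y hy
  · intro d hd
    obtain ⟨ε, hε, h⟩ := h₂ d hd
    have h3 := vsub_mem_vectorSpan ℝ h hx
    rw [vsub_eq_sub, add_sub_cancel_left] at h3
    exact (Submodule.smul_mem_iff _ hε).mp h3

end InnerProduct

variable {n : ℕ} {ι : Type} {P : Set (EuclideanSpace ℝ (Fin n))}
  {a : ι → EuclideanSpace ℝ (Fin n)} {b : ι → ℝ}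

theorem IsConvexPolytope.exists_irredundant_normals (hP : IsConvexPolytope P) :
    ∃ (κ : Type) (_ : Fintype κ) (a : κ → EuclideanSpace ℝ (Fin n)) (b : κ → ℝ),
      P = {x | ∀ i, inner ℝ (a i) x ≤ b i} ∧ (∀ i, ‖a i‖ = 1) ∧
      ∀ i, ∃ z, b i < inner ℝ (a i) z ∧ ∀ k, k ≠ i → inner ℝ (a k) z ≤ b k := by
  obtain ⟨⟨𝓗, hfin, hhalf, rfl⟩, -, -⟩ := hP
  obtain ⟨t, hts, ht, hirr⟩ := exists_irredundant_subfamily (V := Set.univ) (P := ⋂₀ 𝓗)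
    (C := fun H : Set (EuclideanSpace ℝ (Fin n)) => H) hfin.toFinset
    (fun x _ h H hH => h H (hfin.mem_toFinset.mpr hH))
  choose! u c hu hH using hhalf
  have hmem : ∀ H ∈ t, H ∈ 𝓗 := fun H hH => hfin.mem_toFinset.mp (hts hH)
  have hpos : ∀ H ∈ t, 0 < ‖u H‖⁻¹ := fun H h => inv_pos.mpr (norm_pos_iff.mpr (hu H (hmem H h)))
  have hiff : ∀ H ∈ t, ∀ x, x ∈ H ↔ inner ℝ (‖u H‖⁻¹ • u H) x ≤ ‖u H‖⁻¹ * c H := by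
    intro H h x
    rw [real_inner_smul_left, mul_le_mul_iff_right₀ (hpos H h)]
    conv_lhs => rw [hH H (hmem H h)]
    rfl
  refine ⟨t, inferInstance, fun H => ‖u H‖⁻¹ • u H, fun H => ‖u H‖⁻¹ * c H, ?_, ?_, ?_⟩
  · ext x
    refine ⟨fun hx H => (hiff H H.2 x).mp (hx H (hmem H H.2)), fun hx => ht x trivial fun H h => ?_⟩
    exact (hiff H h x).mpr (hx ⟨H, h⟩)
  · intro H
    exact norm_smul_inv_norm (hu H (hmem H H.2))
  · intro H
    obtain ⟨y, -, -, hyH, hy⟩ := hirr H H.2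
    refine ⟨y, ?_, fun K hK => (hiff K K.2 y).mp (hy K K.2 fun h => hK (Subtype.ext h))⟩
    exact lt_of_not_ge fun h => hyH ((hiff H H.2 y).mpr h)

theorem inner_lt_of_mem_interior (hP : P = {x | ∀ i, inner ℝ (a i) x ≤ b i})
    {o : EuclideanSpace ℝ (Fin n)} (ho : o ∈ interior P) {i : ι} (ha : a i ≠ 0) :
    inner ℝ (a i) o < b i := by
  have hc : Continuous fun ε : ℝ => o + ε • a i := by fun_prop
  have h : ∀ᶠ ε in 𝓝 (0 : ℝ), o + ε • a i ∈ P :=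
    (hc.tendsto 0).eventually_mem (by simpa using mem_interior_iff_mem_nhds.mp ho)
  obtain ⟨ε, hε, hε0⟩ := ((h.filter_mono nhdsWithin_le_nhds).and
    (self_mem_nhdsWithin : ∀ᶠ ε in 𝓝[>] (0 : ℝ), ε ∈ Set.Ioi 0)).exists
  rw [hP] at hε
  have := hε i
  rw [inner_add_right, real_inner_smul_right] at this
  have := mul_pos (show (0 : ℝ) < ε from hε0) (real_inner_self_pos.mpr ha)
  linarith

theorem isFacet_inter_hyperplane [Finite ι] (hP : P = {x | ∀ i, inner ℝ (a i) x ≤ b i})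
    (ha : ∀ i, ‖a i‖ = 1) {i : ι} {x : EuclideanSpace ℝ (Fin n)} (hx : inner ℝ (a i) x = b i)
    (hxk : ∀ k, k ≠ i → inner ℝ (a k) x < b k) :
    IsFacet P (P ∩ {x | inner ℝ (a i) x = b i}) := by
  have ha0 : a i ≠ 0 := fun h => by simpa [h] using ha i
  have hxP : x ∈ P := by
    rw [hP]
    intro k
    rcases eq_or_ne k i with rfl | hk
    exacts [hx.le, (hxk k hk).le]
  refine ⟨⟨_, ⟨a i, b i, ha0, rfl, fun y hy => ?_, ⟨x, hxP, hx⟩⟩, rfl⟩, ?_⟩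
  · rw [hP] at hy; exact hy i
  have hspan : vectorSpan ℝ (P ∩ {x | inner ℝ (a i) x = b i}) = (Submodule.span ℝ {a i})ᗮ := by
    refine vectorSpan_eq_of_directions (x := x) ⟨hxP, hx⟩ (fun y hy => ?_) fun d hd => ?_
    · rw [Submodule.mem_orthogonal_singleton_iff_inner_right, inner_sub_right, hx, hy.2, sub_self]
    · rw [Submodule.mem_orthogonal_singleton_iff_inner_right] at hd
      have hev : ∀ᶠ ε in 𝓝[>] (0 : ℝ), ∀ k, k ≠ i → inner ℝ (a k) (x + ε • d) < b k := by
        refine (eventually_all.mpr fun k => ?_).filter_mono nhdsWithin_le_nhds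
        by_cases hk : k = i
        · simp [hk]
        · exact (eventually_inner_add_smul_lt (hxk k hk) d).mono fun ε h _ => h
      obtain ⟨ε, hε, hε0⟩ := (hev.and self_mem_nhdsWithin).exists
      have hi : inner ℝ (a i) (x + ε • d) = b i := by
        rw [inner_add_right, real_inner_smul_right, hd, hx, mul_zero, add_zero]
      refine ⟨ε, ne_of_gt hε0, ?_, hi⟩
      rw [hP]
      intro k
      rcases eq_or_ne k i with rfl | hk
      exacts [hi.le, (hε k hk).le]
  rw [affineDim, hspan]
  have := Submodule.finrank_add_finrank_orthogonal (Submodule.span ℝ {a i})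
  rw [finrank_span_singleton ha0, finrank_euclideanSpace_fin] at this
  omega

theorem isInwardUnitNormal_neg (hP : P = {x | ∀ i, inner ℝ (a i) x ≤ b i})
    (ha : ∀ i, ‖a i‖ = 1) (i : ι) :
    IsInwardUnitNormal P (P ∩ {x | inner ℝ (a i) x = b i}) (-a i) := by
  refine ⟨by rw [norm_neg, ha], fun x hx y hy => ?_⟩
  rw [hP] at hy
  have h1 : inner ℝ (a i) x = b i := hx.2
  have h2 := hy i
  rw [inner_neg_left, inner_sub_right]
  linarith

/-- In an acute polytope all pairs of distinct facet normals, of adjacent facets or not, form an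
obtuse angle. For adjacent facets this is the hypothesis. Otherwise a point that violates only
the constraint `j` is moved along `a i` to the hyperplane of the facet `i`; as this decreases
`⟪a k, ·⟫` for the facets `k` adjacent to `i`, which suffice to describe the facet `i`, it arrives
in `P`, so that `⟪a j, ·⟫` has decreased as well. -/
theorem IsAcute.pairwise_inner_neg [Fintype ι] (hacute : IsAcute P)
    (hP : P = {x | ∀ i, inner ℝ (a i) x ≤ b i}) (ha : ∀ i, ‖a i‖ = 1)
    (hirr : ∀ i, ∃ z, b i < inner ℝ (a i) z ∧ ∀ k, k ≠ i → inner ℝ (a k) z ≤ b k)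
    {o : EuclideanSpace ℝ (Fin n)} (ho : ∀ i, inner ℝ (a i) o < b i) :
    Pairwise fun i j => inner ℝ (a i) (a j) < 0 := by
  classical
  have hpt : ∀ i, ∃ x, inner ℝ (a i) x = b i ∧ ∀ k, k ≠ i → inner ℝ (a k) x < b k := by
    intro i
    obtain ⟨z, hz, hzk⟩ := hirr i
    obtain ⟨x, hx, hxk, -⟩ := exists_mem_hyperplane_of_crossing (ho i) hz
    exact ⟨x, hx, fun k hk => hxk _ _ (ho k) (hzk k hk)⟩
  choose x hx hxk using hpt
  intro i j hij
  -- the constraints in `K` are irredundant inside the hyperplane of the facet `i`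
  obtain ⟨K, hK, hKP, hKirr⟩ := exists_irredundant_subfamily (P := P)
    (V := {y | inner ℝ (a i) y = b i}) (C := fun k => {y | inner ℝ (a k) y ≤ b k})
    (Finset.univ.erase i) (fun y hy h => by
      rw [hP]
      intro k
      rcases eq_or_ne k i with rfl | hk
      exacts [le_of_eq hy, h k (Finset.mem_erase.mpr ⟨hk, Finset.mem_univ k⟩)])
  have hKi : ∀ k ∈ K, k ≠ i := fun k hk => (Finset.mem_erase.mp (hK hk)).1
  -- facets indexed by `K` are adjacent to the facet `i`
  have hneg : ∀ k ∈ K, inner ℝ (a i) (a k) < 0 := by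
    intro k hk
    obtain ⟨y, hyV, -, hyk, hy⟩ := hKirr k hk
    -- `w` is a relative interior point of the common face of the facets `i` and `k`
    have hyk' : b k < inner ℝ (a k) y := lt_of_not_ge hyk
    obtain ⟨w, hwk, hw, hwi⟩ := exists_mem_hyperplane_of_crossing (hxk i k (hKi k hk)) hyk'
    have hwi' : inner ℝ (a i) w = b i := hwi _ _ (hx i) hyV
    have hw' : ∀ l ∈ K, l ≠ k → inner ℝ (a l) w < b l := fun l hl hlk =>
      hw _ _ (hxk i l (hKi l hl)) (hy l hl hlk)
    set F := P ∩ {x | inner ℝ (a i) x = b i} with hF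
    set G := P ∩ {x | inner ℝ (a k) x = b k} with hG
    have hmem : ∀ y, inner ℝ (a i) y = b i → inner ℝ (a k) y = b k →
        (∀ l ∈ K, l ≠ k → inner ℝ (a l) y < b l) → y ∈ F ∩ G := by
      intro y h1 h2 h3
      have hyP : y ∈ P := hKP y h1 fun l hl => by
        rcases eq_or_ne l k with rfl | hlk
        exacts [h2.le, (h3 l hl hlk).le]
      exact ⟨⟨hyP, h1⟩, hyP, h2⟩
    have hwFG := hmem w hwi' hwk hw'
    have hspan : vectorSpan ℝ (F ∩ G) = (Submodule.span ℝ {a i, a k})ᗮ := by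
      have horth : ∀ d, d ∈ (Submodule.span ℝ {a i, a k})ᗮ ↔
          inner ℝ (a i) d = 0 ∧ inner ℝ (a k) d = 0 := by
        intro d
        rw [Submodule.mem_orthogonal]
        refine ⟨fun h => ⟨h _ (Submodule.subset_span (by simp)),
          h _ (Submodule.subset_span (by simp))⟩, fun h u hu => ?_⟩
        obtain ⟨s, t, rfl⟩ := Submodule.mem_span_pair.mp hu
        rw [inner_add_left, real_inner_smul_left, real_inner_smul_left, h.1, h.2]; ring
      refine vectorSpan_eq_of_directions hwFG (fun y hy => ?_) fun d hd => ?_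
      · rw [horth, inner_sub_right, inner_sub_right, hwi', hwk, hy.1.2, hy.2.2]
        simp
      · rw [horth] at hd
        have hev : ∀ᶠ ε in 𝓝[>] (0 : ℝ), ∀ l ∈ K, l ≠ k → inner ℝ (a l) (w + ε • d) < b l := by
          refine (eventually_all.mpr fun l => ?_).filter_mono nhdsWithin_le_nhds
          by_cases hl : l ∈ K ∧ l ≠ k
          · exact (eventually_inner_add_smul_lt (hw' l hl.1 hl.2) d).mono fun ε h _ _ => h
          · exact Eventually.of_forall fun ε h1 h2 => absurd ⟨h1, h2⟩ hl
        obtain ⟨ε, hε, hε0⟩ := (hev.and self_mem_nhdsWithin).exists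
        refine ⟨ε, ne_of_gt hε0, hmem _ ?_ ?_ hε⟩
        · rw [inner_add_right, real_inner_smul_right, hd.1, hwi', mul_zero, add_zero]
        · rw [inner_add_right, real_inner_smul_right, hd.2, hwk, mul_zero, add_zero]
    have hli : LinearIndependent ℝ ![a i, a k] := by
      have ha0 : a i ≠ 0 := fun h => by simpa [h] using ha i
      rw [LinearIndependent.pair_iff' ha0]
      intro t ht
      have h1 : inner ℝ (a k) (y - w) = 0 := by
        rw [← ht, real_inner_smul_left, inner_sub_right, hwi', hyV, sub_self, mul_zero]
      rw [inner_sub_right, hwk] at h1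
      linarith
    have hdim : affineDim (F ∩ G) + 2 = n := by
      rw [affineDim, hspan]
      have h1 := Submodule.finrank_add_finrank_orthogonal (Submodule.span ℝ {a i, a k})
      have h2 := finrank_span_eq_card hli
      rw [Matrix.range_cons_cons_empty, Fintype.card_fin] at h2
      rw [h2, finrank_euclideanSpace_fin] at h1
      omega
    have hne : F ≠ G := fun h => by
      have h1 : x i ∈ F := by
        refine ⟨?_, hx i⟩
        rw [hP]
        intro l
        rcases eq_or_ne l i with rfl | hl
        exacts [(hx l).le, (hxk i l hl).le]
      rw [h] at h1
      exact (hxk i k (hKi k hk)).ne h1.2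
    have hang := hacute F G (isFacet_inter_hyperplane hP ha (hx i) (hxk i))
      (isFacet_inter_hyperplane hP ha (hx k) (hxk k)) hne ⟨w, hwFG⟩ hdim _ _
      (isInwardUnitNormal_neg hP ha i) (isInwardUnitNormal_neg hP ha k)
    rw [dihedralAngle, InnerProductGeometry.angle_neg_neg] at hang
    have hcos : Real.cos (InnerProductGeometry.angle (a i) (a k)) < 0 :=
      Real.cos_neg_of_pi_div_two_lt_of_lt (by linarith [hang.2])
        (by linarith [InnerProductGeometry.angle_le_pi (a i) (a k), Real.pi_pos])
    rw [InnerProductGeometry.cos_angle, ha, ha] at hcos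
    simpa using hcos
  by_cases hj : j ∈ K
  · exact hneg j hj
  -- a point violating only the constraint `j`, projected to the hyperplane of the facet `i`
  obtain ⟨z, hz, hzk⟩ := hirr j
  have ht : 0 ≤ b i - inner ℝ (a i) z := by linarith [hzk i hij]
  have hy : z + (b i - inner ℝ (a i) z) • a i ∈ P := by
    refine hKP _ ?_ fun k hk => ?_
    · change inner ℝ (a i) _ = b i
      rw [inner_add_right, real_inner_smul_right, real_inner_self_eq_norm_sq, ha]
      ring
    · change inner ℝ (a k) _ ≤ b k
      rw [inner_add_right, real_inner_smul_right, real_inner_comm (a i) (a k)]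
      have h1 := mul_nonpos_of_nonneg_of_nonpos ht (hneg k hk).le
      have h2 := hzk k fun h => hj (h ▸ hk)
      linarith
  rw [hP] at hy
  have h := hy j
  rw [inner_add_right, real_inner_smul_right, real_inner_comm (a i) (a j)] at h
  by_contra hcon
  have := mul_nonneg ht (not_lt.mp hcon)
  linarith

end Normals

/-! ### Acute polytopes are simplices -/

/-- `P` is the simplex with outward facet normals `a i`, not necessarily of norm one, and facets on
the hyperplanes `⟪a i, x⟫ = b i`, any two of which have an acute dihedral angle. The last two
fields record in the form needed later that the normals satisfy a linear relation with positive
coefficients: the half-spaces opposite to the facets have no common point, and intersections of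
translates of these half-spaces are bounded. -/
structure IsObtuseSimplex {n : ℕ} {ι : Type} [Fintype ι] (P : Set (EuclideanSpace ℝ (Fin n)))
    (a : ι → EuclideanSpace ℝ (Fin n)) (b : ι → ℝ) : Prop where
  eq_setOf : P = {x | ∀ i, inner ℝ (a i) x ≤ b i}
  ne_zero : ∀ i, a i ≠ 0
  pairwise_inner_neg : Pairwise fun i j => inner ℝ (a i) (a j) < 0
  span_eq_top : Submodule.span ℝ (Set.range a) = ⊤
  card_eq : Fintype.card ι = n + 1
  exists_inner_lt : ∀ x, ∃ i, inner ℝ (a i) x < b i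
  isBounded_of_le : ∀ β : ι → ℝ, Bornology.IsBounded {x | ∀ i, β i ≤ inner ℝ (a i) x}

/-- A bounded polytope has no direction of recession. -/
theorem eq_zero_of_inner_nonpos {n : ℕ} {ι : Type} {P : Set (EuclideanSpace ℝ (Fin n))}
    {a : ι → EuclideanSpace ℝ (Fin n)} {b : ι → ℝ} (hP : P = {x | ∀ i, inner ℝ (a i) x ≤ b i})
    (hbdd : Bornology.IsBounded P) {o d : EuclideanSpace ℝ (Fin n)} (ho : o ∈ P)
    (hd : ∀ i, inner ℝ (a i) d ≤ 0) : d = 0 := by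
  by_contra hd0
  have hdn : 0 < ‖d‖ := norm_pos_iff.mpr hd0
  obtain ⟨R, hR⟩ := hbdd.exists_norm_le
  have hR0 : 0 ≤ R := (norm_nonneg _).trans (hR o ho)
  set t := (R + ‖o‖ + 1) / ‖d‖ with ht
  have ht0 : 0 ≤ t := by positivity
  have hmem : o + t • d ∈ P := by
    rw [hP] at ho ⊢
    intro i
    rw [inner_add_right, real_inner_smul_right]
    have := mul_nonpos_of_nonneg_of_nonpos ht0 (hd i)
    linarith [ho i]
  have h1 : ‖t • d‖ = R + ‖o‖ + 1 := by
    rw [norm_smul, Real.norm_of_nonneg ht0, ht]; field_simp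
  have h2 : ‖t • d‖ ≤ ‖o + t • d‖ + ‖o‖ := by
    have := norm_sub_le (o + t • d) o
    rwa [add_sub_cancel_left] at this
  linarith [hR _ hmem]

/-- Acute polytopes are simplices: the relation between their normals is unique up to a factor and
involves all of them, so there is one normal more than the dimension. -/
theorem IsAcute.exists_isObtuseSimplex {n : ℕ} (hn : 0 < n) {P : Set (EuclideanSpace ℝ (Fin n))}
    (hP : IsConvexPolytope P) (hacute : IsAcute P) :
    ∃ (ι : Type) (_ : Fintype ι) (a : ι → EuclideanSpace ℝ (Fin n)) (b : ι → ℝ),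
      IsObtuseSimplex P a b := by
  classical
  obtain ⟨ι, hι, a, b, hPe, hau, hirr⟩ := hP.exists_irredundant_normals
  obtain ⟨-, hbdd, o, ho⟩ := hP
  have ha0 : ∀ i, a i ≠ 0 := fun i h => by simpa [h] using hau i
  have hoi : ∀ i, inner ℝ (a i) o < b i := fun i => inner_lt_of_mem_interior hPe ho (ha0 i)
  have hneg := hacute.pairwise_inner_neg hPe hau hirr hoi
  have hrec : ∀ d, (∀ i, inner ℝ (a i) d ≤ 0) → d = 0 := fun d =>
    eq_zero_of_inner_nonpos hPe hbdd (interior_subset ho)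
  have hspan : Submodule.span ℝ (Set.range a) = ⊤ := by
    rw [← Submodule.orthogonal_eq_bot_iff, Submodule.eq_bot_iff]
    refine fun d hd => hrec d fun i => le_of_eq ?_
    exact (Submodule.mem_orthogonal _ _).mp hd _ (Submodule.subset_span ⟨i, rfl⟩)
  -- the positive relation between the normals
  obtain ⟨w, hw, hwpos⟩ : ∃ w : ι → ℝ, ∑ i, w i • a i = 0 ∧ ∃ i, 0 < w i := by
    have hdep : ¬ LinearIndependent ℝ a := by
      intro h
      obtain ⟨d, hd⟩ := exists_inner_eq_of_linearIndepOn (linearIndepOn_univ_iff.mpr h)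
        (fun _ => (-1 : ℝ))
      have hd0 := hrec d fun i => by rw [hd i trivial]; norm_num
      rcases isEmpty_or_nonempty ι with hι | ⟨⟨i⟩⟩
      · have h1 := hrec (EuclideanSpace.single ⟨0, hn⟩ (1 : ℝ)) fun i => hι.elim i
        simp at h1
      · have := hd i trivial
        rw [hd0, inner_zero_right] at this
        norm_num at this
    obtain ⟨g, hg, i, hi⟩ := Fintype.not_linearIndependent_iff.mp hdep
    rcases lt_or_gt_of_ne hi with hi | hi
    · exact ⟨fun i => -g i, by simp [hg], i, by linarith⟩
    · exact ⟨g, hg, i, hi⟩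
  obtain ⟨i₀, hi₀⟩ := hwpos
  have hwp : ∀ i, 0 < w i := fun i => lt_of_not_ge fun h =>
    absurd (coeff_nonpos_of_sum_smul_eq_zero hneg hw h i₀) (not_le.mpr hi₀)
  have hwx : ∀ x, ∑ i, w i * inner ℝ (a i) x = 0 := by
    intro x
    have : inner ℝ (∑ i, w i • a i) x = 0 := by rw [hw, inner_zero_left]
    simpa only [sum_inner, real_inner_smul_left] using this
  refine ⟨ι, hι, a, b, hPe, ha0, hneg, hspan, ?_, ?_, ?_⟩
  · have hli := linearIndepOn_of_pairwise_inner_neg hneg (Finset.notMem_erase i₀ Finset.univ)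
    have h1 := finrank_span_eq_card (R := ℝ) hli
    have h2 : Submodule.span ℝ (Set.range fun i : (Finset.univ.erase i₀ : Finset ι) => a i) = ⊤ := by
      rw [eq_top_iff, ← hspan, Submodule.span_le]
      have hmem : ∀ i, i ≠ i₀ → a i ∈
          Submodule.span ℝ (Set.range fun i : (Finset.univ.erase i₀ : Finset ι) => a i) :=
        fun i hi => Submodule.subset_span ⟨⟨i, by simp [hi]⟩, rfl⟩
      rintro _ ⟨i, rfl⟩
      rcases eq_or_ne i i₀ with rfl | hi
      · rw [SetLike.mem_coe, ← Submodule.smul_mem_iff _ (hwp i).ne']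
        rw [← Finset.add_sum_erase _ _ (Finset.mem_univ i)] at hw
        rw [eq_neg_of_add_eq_zero_left hw]
        exact Submodule.neg_mem _ (Submodule.sum_mem _ fun k hk =>
          Submodule.smul_mem _ _ (hmem k (Finset.ne_of_mem_erase hk)))
      · exact hmem i hi
    have h3 : Module.finrank ℝ (Submodule.span ℝ
        (Set.range fun i : (Finset.univ.erase i₀ : Finset ι) => a i)) = n := by
      rw [h2, finrank_top, finrank_euclideanSpace_fin]
    have h4 : Fintype.card (Finset.univ.erase i₀ : Finset ι) = n := h1.symm.trans h3
    rw [Fintype.card_coe, Finset.card_erase_of_mem (Finset.mem_univ _), Finset.card_univ] at h4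
    have : 0 < Fintype.card ι := Fintype.card_pos_iff.mpr ⟨i₀⟩
    omega
  · intro x
    by_contra! h
    have h1 : ∑ i, w i * inner ℝ (a i) o < ∑ i, w i * inner ℝ (a i) x :=
      Finset.sum_lt_sum_of_nonempty ⟨i₀, Finset.mem_univ _⟩ fun i _ =>
        mul_lt_mul_of_pos_left ((hoi i).trans_le (h i)) (hwp i)
    rw [hwx, hwx] at h1
    exact h1.false
  · intro β
    set T : EuclideanSpace ℝ (Fin n) →ₗ[ℝ] (ι → ℝ) :=
      LinearMap.pi fun i => (innerSL ℝ (a i)).toLinearMap with hT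
    have hTx : ∀ x i, T x i = inner ℝ (a i) x := fun x i => rfl
    obtain ⟨C, -, hC⟩ := T.exists_antilipschitzWith (by
      rw [LinearMap.ker_eq_bot']
      exact fun x hx => hrec x fun i => le_of_eq (congrFun hx i))
    refine (hC.isBounded_preimage (Metric.isBounded_Icc β
      fun i => β i + (-∑ k, w k * β k) / w i)).subset fun x hx => ⟨fun i => hx i, fun i => ?_⟩
    rw [hTx, ← sub_le_iff_le_add', le_div_iff₀ (hwp i)]
    have h1 : ∑ k, w k * (inner ℝ (a k) x - β k) = -∑ k, w k * β k := by
      simp only [mul_sub, Finset.sum_sub_distrib, hwx, zero_sub]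
    rw [← h1, mul_comm]
    exact Finset.single_le_sum (f := fun k => w k * (inner ℝ (a k) x - β k))
      (fun k _ => mul_nonneg (hwp k).le (sub_nonneg.mpr (hx k))) (Finset.mem_univ i)

/-! ### Lengths of closed polygons and their variation -/

section Polygons

section FirstVariation

variable {F : Type*} [NormedAddCommGroup F] [InnerProductSpace ℝ F]

/-- The first order expansion of the norm with an explicit quadratic error, which follows from
`2 * ‖w‖ * ‖w + d‖ ≤ ‖w + d‖ ^ 2 + ‖w‖ ^ 2`. -/
theorem norm_add_le_norm_add_inner {w : F} (hw : w ≠ 0) (d : F) :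
    ‖w + d‖ ≤ ‖w‖ + inner ℝ (‖w‖⁻¹ • w) d + ‖d‖ ^ 2 * (2 * ‖w‖)⁻¹ := by
  have hpos : 0 < ‖w‖ := norm_pos_iff.mpr hw
  have h1 := norm_add_sq_real w d
  have h2 : ‖w + d‖ * (2 * ‖w‖) ≤ ‖w + d‖ ^ 2 + ‖w‖ ^ 2 := by
    nlinarith [sq_nonneg (‖w + d‖ - ‖w‖)]
  rw [real_inner_smul_left]
  have h3 : ‖w‖ + ‖w‖⁻¹ * inner ℝ w d + ‖d‖ ^ 2 * (2 * ‖w‖)⁻¹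
      = (‖w + d‖ ^ 2 + ‖w‖ ^ 2) / (2 * ‖w‖) := by
    rw [h1]; field_simp; ring
  rw [h3, le_div_iff₀ (by positivity)]
  exact h2

theorem eventually_mul_add_sq_mul_neg {s : ℝ} (hs : s < 0) (C : ℝ) :
    ∀ᶠ ε in 𝓝[>] (0 : ℝ), ε * s + ε ^ 2 * C < 0 := by
  have hc : Continuous fun ε : ℝ => s + ε * C := by fun_prop
  have h : ∀ᶠ ε in 𝓝[>] (0 : ℝ), s + ε * C < 0 :=
    ((hc.tendsto 0).eventually_lt_const (by simpa using hs)).filter_mono nhdsWithin_le_nhds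
  filter_upwards [h, self_mem_nhdsWithin] with ε h1 h2
  have h3 : (0 : ℝ) < ε := h2
  nlinarith

/-- First variation of the sum of the distances of `x` to `A` and to `B`. -/
theorem inner_nonneg_of_eventually_le {A x B : F} (hA : x - A ≠ 0) (hB : B - x ≠ 0) {d : F}
    (h : ∀ᶠ ε in 𝓝[>] (0 : ℝ), ‖x - A‖ + ‖B - x‖ ≤ ‖x + ε • d - A‖ + ‖B - (x + ε • d)‖) :
    0 ≤ inner ℝ (‖x - A‖⁻¹ • (x - A) - ‖B - x‖⁻¹ • (B - x)) d := by
  by_contra! hs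
  obtain ⟨ε, h1, h2⟩ := (h.and (eventually_mul_add_sq_mul_neg hs
    (‖d‖ ^ 2 * (2 * ‖x - A‖)⁻¹ + ‖d‖ ^ 2 * (2 * ‖B - x‖)⁻¹))).exists
  have h3 := norm_add_le_norm_add_inner hA (ε • d)
  have h4 := norm_add_le_norm_add_inner hB (-(ε • d))
  rw [inner_neg_right, norm_neg] at h4
  rw [norm_smul, mul_pow, Real.norm_eq_abs, sq_abs, real_inner_smul_right] at h3 h4
  rw [inner_sub_left] at h2
  have e1 : x + ε • d - A = x - A + ε • d := by abel
  have e2 : B - (x + ε • d) = B - x + -(ε • d) := by abel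
  rw [e1, e2] at h1
  linarith

theorem inner_inv_norm_smul_le_norm (w x : F) : inner ℝ (‖w‖⁻¹ • w) x ≤ ‖x‖ := by
  rcases eq_or_ne w 0 with rfl | hw
  · simp
  · have := real_inner_le_norm (‖w‖⁻¹ • w) x
    rwa [show ‖‖w‖⁻¹ • w‖ = 1 from norm_smul_inv_norm hw, one_mul] at this

theorem inner_inv_norm_smul_self (w : F) : inner ℝ (‖w‖⁻¹ • w) w = ‖w‖ := by
  rcases eq_or_ne w 0 with rfl | hw
  · simp
  · rw [real_inner_smul_left, real_inner_self_eq_norm_sq]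
    have := norm_ne_zero_iff.mpr hw
    field_simp

/-- The sum of the distances to two points is convex, hence minimal where its gradient vanishes. -/
theorem norm_add_norm_le_of_inner_eq_zero {A p B x : F}
    (h : inner ℝ (‖p - A‖⁻¹ • (p - A) - ‖B - p‖⁻¹ • (B - p)) (x - p) = 0) :
    ‖p - A‖ + ‖B - p‖ ≤ ‖x - A‖ + ‖B - x‖ := by
  have h1 := inner_inv_norm_smul_le_norm (p - A) (x - A)
  have h2 := inner_inv_norm_smul_le_norm (B - p) (B - x)
  rw [show x - A = (x - p) + (p - A) by abel, inner_add_right, inner_inv_norm_smul_self] at h1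
  rw [show B - x = (B - p) - (x - p) by abel, inner_sub_right, inner_inv_norm_smul_self] at h2
  rw [inner_sub_left] at h
  rw [show x - A = (x - p) + (p - A) by abel, show B - x = (B - p) - (x - p) by abel]
  linarith

end FirstVariation

variable {n : ℕ}

theorem next_prev {m : ℕ} (j : Fin m) : next (prev j) = j := (finRotate m).apply_symm_apply j

theorem prev_next {m : ℕ} (j : Fin m) : prev (next j) = j := (finRotate m).symm_apply_apply j

theorem next_eq_add_one {k : ℕ} (j : Fin (k + 1)) : next j = j + 1 := finRotate_apply j

theorem next_ne {k : ℕ} (j : Fin (k + 2)) : next j ≠ j := by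
  rw [next_eq_add_one]
  simp

theorem prev_ne {k : ℕ} (j : Fin (k + 2)) : prev j ≠ j := fun h =>
  next_ne j (by nth_rewrite 1 [← h]; exact next_prev j)

/-- The length of the open polygonal line with vertices `q₀, …, q_k`. -/
noncomputable def pathLength {k : ℕ} (q : Fin (k + 1) → EuclideanSpace ℝ (Fin n)) : ℝ :=
  ∑ i : Fin k, ‖q i.succ - q i.castSucc‖

theorem length_eq_pathLength_add {k : ℕ} (q : Fin (k + 1) → EuclideanSpace ℝ (Fin n)) :
    length q = pathLength q + ‖q 0 - q (Fin.last k)‖ := by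
  simp [length, pathLength, Fin.sum_univ_castSucc, next_eq_add_one]

theorem pathLength_snoc {k : ℕ} (q : Fin (k + 1) → EuclideanSpace ℝ (Fin n))
    (y : EuclideanSpace ℝ (Fin n)) :
    pathLength (Fin.snoc q y : Fin (k + 2) → EuclideanSpace ℝ (Fin n))
      = pathLength q + ‖y - q (Fin.last k)‖ := by
  rw [pathLength, Fin.sum_univ_castSucc, pathLength]
  congr 1
  · refine Finset.sum_congr rfl fun i _ => ?_
    rw [← Fin.castSucc_succ, Fin.snoc_castSucc, Fin.snoc_castSucc]
  · rw [Fin.succ_last, Fin.snoc_last, Fin.snoc_castSucc]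

theorem length_snoc {k : ℕ} (q : Fin (k + 1) → EuclideanSpace ℝ (Fin n))
    (y : EuclideanSpace ℝ (Fin n)) :
    length (Fin.snoc q y : Fin (k + 2) → EuclideanSpace ℝ (Fin n))
      = pathLength q + (‖y - q (Fin.last k)‖ + ‖q 0 - y‖) := by
  rw [length_eq_pathLength_add, pathLength_snoc, Fin.snoc_last, ← Fin.castSucc_zero,
    Fin.snoc_castSucc, add_assoc]

/-- The polygonal line obtained from a closed polygon by deleting the vertex `j`; it starts at the
successor of `j` and ends at its predecessor. -/
def cutAt {k : ℕ} (p : Fin (k + 2) → EuclideanSpace ℝ (Fin n)) (j : Fin (k + 2)) :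
    Fin (k + 1) → EuclideanSpace ℝ (Fin n) :=
  fun i => p (i.castSucc + (j + 1))

/-- Putting the vertex `j` back at the end of the cut polygon gives a cyclic rotation of it. -/
theorem snoc_cutAt {k : ℕ} (p : Fin (k + 2) → EuclideanSpace ℝ (Fin n)) (j : Fin (k + 2)) :
    (Fin.snoc (cutAt p j) (p j) : Fin (k + 2) → EuclideanSpace ℝ (Fin n))
      = fun i => p (i + (j + 1)) := by
  ext1 i
  induction i using Fin.lastCases with
  | last =>
    rw [Fin.snoc_last, add_comm j 1, ← add_assoc, Fin.last_add_one, zero_add]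
  | cast i => rw [Fin.snoc_castSucc]; rfl

theorem cutAt_zero {k : ℕ} (p : Fin (k + 2) → EuclideanSpace ℝ (Fin n)) (j : Fin (k + 2)) :
    cutAt p j 0 = p (next j) := by
  rw [cutAt, next_eq_add_one, Fin.castSucc_zero, zero_add]

theorem cutAt_last {k : ℕ} (p : Fin (k + 2) → EuclideanSpace ℝ (Fin n)) (j : Fin (k + 2)) :
    cutAt p j (Fin.last k) = p (prev j) := by
  rw [cutAt]
  congr 1
  have h : next ((Fin.last k).castSucc + (j + 1)) = j := by
    have h2 : (Fin.last k).castSucc + 1 = Fin.last (k + 1) := by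
      rw [Fin.coeSucc_eq_succ, Fin.succ_last]
    rw [next_eq_add_one, add_right_comm, h2, add_comm j 1, ← add_assoc, Fin.last_add_one, zero_add]
  rw [← prev_next ((Fin.last k).castSucc + (j + 1)), h]

theorem exists_cutAt_eq {k : ℕ} (p : Fin (k + 2) → EuclideanSpace ℝ (Fin n)) {j l : Fin (k + 2)}
    (h : l ≠ j) : ∃ i, cutAt p j i = p l := by
  have h1 : l - (j + 1) ≠ Fin.last (k + 1) := fun h2 => h <| by
    rw [sub_eq_iff_eq_add] at h2
    rw [h2, add_comm j 1, ← add_assoc, Fin.last_add_one, zero_add]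
  obtain ⟨i, hi⟩ := Fin.exists_castSucc_eq.mpr h1
  exact ⟨i, by rw [cutAt, hi, sub_add_cancel]⟩

theorem length_comp_add_right {k : ℕ} (p : Fin (k + 1) → EuclideanSpace ℝ (Fin n))
    (c : Fin (k + 1)) : length (fun i => p (i + c)) = length p := by
  rw [length, length, ← Equiv.sum_comp (Equiv.addRight c) fun i => ‖p (next i) - p i‖]
  refine Finset.sum_congr rfl fun i _ => ?_
  simp only [next_eq_add_one, Equiv.coe_addRight, add_right_comm]

theorem length_eq_pathLength_cutAt_add {k : ℕ} (p : Fin (k + 2) → EuclideanSpace ℝ (Fin n))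
    (j : Fin (k + 2)) :
    length p = pathLength (cutAt p j) + (‖p j - p (prev j)‖ + ‖p (next j) - p j‖) := by
  rw [← length_comp_add_right p (j + 1), ← snoc_cutAt, length_snoc, cutAt_zero, cutAt_last]

theorem length_cutAt {k : ℕ} (p : Fin (k + 2) → EuclideanSpace ℝ (Fin n)) (j : Fin (k + 2)) :
    length (cutAt p j) = pathLength (cutAt p j) + ‖p (next j) - p (prev j)‖ := by
  rw [length_eq_pathLength_add, cutAt_zero, cutAt_last]

theorem length_cutAt_le {k : ℕ} (p : Fin (k + 2) → EuclideanSpace ℝ (Fin n)) (j : Fin (k + 2)) :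
    length (cutAt p j) ≤ length p := by
  rw [length_cutAt, length_eq_pathLength_cutAt_add p j, add_comm ‖p j - p (prev j)‖]
  have := norm_add_le (p (next j) - p j) (p j - p (prev j))
  rw [sub_add_sub_cancel] at this
  linarith

theorem length_cutAt_lt {k : ℕ} (p : Fin (k + 2) → EuclideanSpace ℝ (Fin n)) {j : Fin (k + 2)}
    (h : p j ∉ segment ℝ (p (prev j)) (p (next j))) : length (cutAt p j) < length p := by
  refine (length_cutAt_le p j).lt_of_ne fun heq => h ?_
  rw [length_cutAt, length_eq_pathLength_cutAt_add p j, add_right_inj] at heq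
  rw [mem_segment_iff_wbtw, ← dist_add_dist_eq_iff, dist_comm, dist_eq_norm, dist_comm,
    dist_eq_norm, dist_comm, dist_eq_norm, heq]

/-- The difference of the unit directions in which a closed polygon enters and leaves its vertex
`j`, which is the gradient of the length with respect to that vertex. -/
noncomputable def bend {m : ℕ} (p : Fin m → EuclideanSpace ℝ (Fin n)) (j : Fin m) :
    EuclideanSpace ℝ (Fin n) :=
  ‖p j - p (prev j)‖⁻¹ • (p j - p (prev j)) - ‖p (next j) - p j‖⁻¹ • (p (next j) - p j)

theorem sum_bend {m : ℕ} (p : Fin m → EuclideanSpace ℝ (Fin n)) : ∑ j, bend p j = 0 := by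
  simp only [bend, Finset.sum_sub_distrib]
  rw [sub_eq_zero, ← Equiv.sum_comp (finRotate m)]
  refine Finset.sum_congr rfl fun j _ => ?_
  change ‖p (next j) - p (prev (next j))‖⁻¹ • (p (next j) - p (prev (next j))) = _
  rw [prev_next]

theorem bend_ne_zero {k : ℕ} {p : Fin (k + 2) → EuclideanSpace ℝ (Fin n)}
    (hp : Function.Injective p) {j : Fin (k + 2)}
    (h : p j ∉ segment ℝ (p (prev j)) (p (next j))) : bend p j ≠ 0 := by
  intro h0
  have h1 : p j - p (prev j) ≠ 0 := sub_ne_zero.mpr fun h => prev_ne j (hp h).symm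
  have h2 : p (next j) - p j ≠ 0 := sub_ne_zero.mpr fun h => next_ne j (hp h)
  rw [mem_segment_iff_sameRay, sameRay_iff_inv_norm_smul_eq_of_ne h1 h2] at h
  exact h (sub_eq_zero.mp h0)

end Polygons

/-! ### Shortest polygons reaching all facet hyperplanes -/

section Reaching

variable {n : ℕ} {ι : Type} {P : Set (EuclideanSpace ℝ (Fin n))}
  {a : ι → EuclideanSpace ℝ (Fin n)} {b : ι → ℝ}

/-- Every closed half-space `{x | b i ≤ ⟪a i, x⟫}` contains a vertex of the polygon `q`.
Up to translation, these are the polygons that no translation moves into the interior of the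
simplex. In contrast to
the vertices of a billiard trajectory, those of `q` need not lie in the polytope. -/
def ReachesAll (a : ι → EuclideanSpace ℝ (Fin n)) (b : ι → ℝ) {m : ℕ}
    (q : Fin m → EuclideanSpace ℝ (Fin n)) : Prop :=
  ∀ i, ∃ j, b i ≤ inner ℝ (a i) (q j)

theorem ReachesAll.snoc_cutAt {k : ℕ} {q : Fin (k + 2) → EuclideanSpace ℝ (Fin n)}
    {j : Fin (k + 2)} {y : EuclideanSpace ℝ (Fin n)}
    (h : ∀ i, (∃ l, l ≠ j ∧ b i ≤ inner ℝ (a i) (q l)) ∨ b i ≤ inner ℝ (a i) y) :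
    ReachesAll a b (Fin.snoc (cutAt q j) y : Fin (k + 2) → EuclideanSpace ℝ (Fin n)) := by
  intro i
  rcases h i with ⟨l, hl, h⟩ | h
  · obtain ⟨t, ht⟩ := exists_cutAt_eq q hl
    exact ⟨t.castSucc, by rwa [Fin.snoc_castSucc, ht]⟩
  · exact ⟨Fin.last _, by rwa [Fin.snoc_last]⟩

theorem norm_sub_zero_le_pathLength {k : ℕ} (q : Fin (k + 1) → EuclideanSpace ℝ (Fin n))
    (j : Fin (k + 1)) : ‖q j - q 0‖ ≤ pathLength q := by
  induction k with
  | zero => simp [pathLength, Fin.fin_one_eq_zero j]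
  | succ k ih =>
    obtain ⟨r, y, rfl⟩ : ∃ (r : Fin (k + 1) → EuclideanSpace ℝ (Fin n)) (y : _),
        q = (Fin.snoc r y : Fin (k + 2) → _) := ⟨_, _, (Fin.snoc_init_self q).symm⟩
    rw [pathLength_snoc, ← Fin.castSucc_zero, Fin.snoc_castSucc]
    induction j using Fin.lastCases with
    | last =>
      rw [Fin.snoc_last, ← sub_add_sub_cancel y (r (Fin.last k)) (r 0)]
      linarith [norm_add_le (y - r (Fin.last k)) (r (Fin.last k) - r 0), ih r (Fin.last k)]
    | cast j =>
      rw [Fin.snoc_castSucc]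
      linarith [ih r j, norm_nonneg (y - r (Fin.last k))]

theorem norm_sub_zero_le_length {k : ℕ} (q : Fin (k + 1) → EuclideanSpace ℝ (Fin n))
    (j : Fin (k + 1)) : ‖q j - q 0‖ ≤ length q := by
  rw [length_eq_pathLength_add]
  linarith [norm_sub_zero_le_pathLength q j, norm_nonneg (q 0 - q (Fin.last k))]

variable [Fintype ι]

/-- Among the polygons with a given number of vertices that reach all half-spaces there is a
shortest one: a bound on the length confines them to a compact set. -/
theorem IsObtuseSimplex.exists_shortest (hS : IsObtuseSimplex P a b) {k : ℕ}
    {q₀ : Fin (k + 1) → EuclideanSpace ℝ (Fin n)} (hq₀ : ReachesAll a b q₀) :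
    ∃ q : Fin (k + 1) → EuclideanSpace ℝ (Fin n), ReachesAll a b q ∧
      ∀ r : Fin (k + 1) → EuclideanSpace ℝ (Fin n), ReachesAll a b r → length q ≤ length r := by
  have hcont : Continuous fun q : Fin (k + 1) → EuclideanSpace ℝ (Fin n) => length q := by
    unfold length
    fun_prop
  set K := {q : Fin (k + 1) → EuclideanSpace ℝ (Fin n) | ReachesAll a b q ∧ length q ≤ length q₀}
    with hK
  have hclosed : IsClosed K := by
    refine IsClosed.inter ?_ (isClosed_le hcont continuous_const)
    have : {q : Fin (k + 1) → EuclideanSpace ℝ (Fin n) | ReachesAll a b q}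
        = ⋂ i, ⋃ j, {q | b i ≤ inner ℝ (a i) (q j)} := by
      ext q; simp [ReachesAll]
    change IsClosed {q : Fin (k + 1) → EuclideanSpace ℝ (Fin n) | ReachesAll a b q}
    rw [this]
    exact isClosed_iInter fun i => isClosed_iUnion_of_finite fun j =>
      isClosed_le continuous_const (by fun_prop)
  have hbdd : Bornology.IsBounded K := by
    obtain ⟨R, hR⟩ := (hS.isBounded_of_le fun i => b i - ‖a i‖ * length q₀).exists_norm_le
    refine isBounded_iff_forall_norm_le.mpr ⟨R + length q₀, fun q hq => ?_⟩
    have hq0 : ‖q 0‖ ≤ R := hR _ fun i => by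
      obtain ⟨j, hj⟩ := hq.1 i
      have h1 := real_inner_le_norm (a i) (q j - q 0)
      have h2 := mul_le_mul_of_nonneg_left ((norm_sub_zero_le_length q j).trans hq.2)
        (norm_nonneg (a i))
      rw [inner_sub_right] at h1
      linarith
    have hq1 : ∀ j, ‖q j‖ ≤ R + length q₀ := fun j => by
      have h1 := norm_add_le (q 0) (q j - q 0)
      rw [add_sub_cancel] at h1
      linarith [(norm_sub_zero_le_length q j).trans hq.2]
    exact (pi_norm_le_iff_of_nonneg ((norm_nonneg _).trans (hq1 0))).mpr hq1
  obtain ⟨q, hq, hmin⟩ := (Metric.isCompact_of_isClosed_isBounded hclosed hbdd).exists_isMinOn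
    ⟨q₀, hq₀, le_rfl⟩ hcont.continuousOn
  refine ⟨q, hq.1, fun r hr => ?_⟩
  rcases le_total (length r) (length q₀) with h | h
  · exact hmin ⟨hr, h⟩
  · exact hq.2.trans h

/-- The bends of a closed polygon sum to zero, so a presentation of them by nonnegative
combinations of the normals involves every normal. -/
theorem IsObtuseSimplex.exists_pos_coeff (hS : IsObtuseSimplex P a b) {m : ℕ}
    {p : Fin m → EuclideanSpace ℝ (Fin n)} {c : Fin m → ι → ℝ} (hc : ∀ j i, 0 ≤ c j i)
    (hb : ∀ j, bend p j = ∑ i, c j i • a i) {j₀ : Fin m} (hj₀ : bend p j₀ ≠ 0) (i : ι) :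
    ∃ j, 0 < c j i := by
  by_contra! h
  have hsum : ∑ i, (∑ j, c j i) • a i = 0 := by
    rw [← sum_bend p]
    simp only [hb, Finset.sum_smul]
    exact Finset.sum_comm
  have hall := coeff_nonpos_of_sum_smul_eq_zero hS.pairwise_inner_neg hsum (i₀ := i)
    (Finset.sum_nonpos fun j _ => h j)
  apply hj₀
  rw [hb]
  refine Finset.sum_eq_zero fun k _ => ?_
  have h1 : c j₀ k ≤ ∑ j, c j k :=
    Finset.single_le_sum (f := fun j => c j k) (fun j _ => hc j k) (Finset.mem_univ j₀)
  rw [le_antisymm (h1.trans (hall k)) (hc j₀ k), zero_smul]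

theorem IsObtuseSimplex.isClosed (hS : IsObtuseSimplex P a b) : IsClosed P := by
  have : P = ⋂ i, {x | inner ℝ (a i) x ≤ b i} := by
    rw [hS.eq_setOf]; ext x; simp
  rw [this]
  exact isClosed_iInter fun i => isClosed_le (by fun_prop) continuous_const

/-- A shortest polygon reaching all half-spaces, none of whose vertices can be omitted, is a
billiard trajectory. -/
theorem IsObtuseSimplex.isClosedBilliardTrajectory_of_shortest (hS : IsObtuseSimplex P a b) {k : ℕ}
    {q : Fin (k + 2) → EuclideanSpace ℝ (Fin n)} (hq : ReachesAll a b q)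
    (hmin : ∀ r : Fin (k + 2) → EuclideanSpace ℝ (Fin n), ReachesAll a b r → length q ≤ length r)
    (hcut : ∀ j, ¬ ReachesAll a b (cutAt q j)) : IsClosedBilliardTrajectory P q := by
  classical
  -- every vertex reaches a half-space that no other vertex reaches
  have hpriv : ∀ j, ∃ i, ∀ l, l ≠ j → inner ℝ (a i) (q l) < b i := by
    intro j
    have h := hcut j
    simp only [ReachesAll] at h
    push Not at h
    obtain ⟨i, hi⟩ := h
    refine ⟨i, fun l hl => ?_⟩
    obtain ⟨t, ht⟩ := exists_cutAt_eq q hl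
    exact ht ▸ hi t
  have hreach : ∀ i j, (∀ l, l ≠ j → inner ℝ (a i) (q l) < b i) → b i ≤ inner ℝ (a i) (q j) := by
    intro i j h
    obtain ⟨l, hl⟩ := hq i
    rcases eq_or_ne l j with rfl | hlj
    exacts [hl, absurd hl (not_le.mpr (h l hlj))]
  have hinj : Function.Injective q := by
    intro j l hjl
    by_contra hne
    obtain ⟨i, hi⟩ := hpriv j
    have h1 := hi l (Ne.symm hne)
    rw [← hjl] at h1
    exact absurd (hreach i j hi) (not_le.mpr h1)
  have hseg : ∀ j, q j ∉ segment ℝ (q (prev j)) (q (next j)) := by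
    rintro j ⟨s, t, hs, ht, hst, heq⟩
    obtain ⟨i, hi⟩ := hpriv j
    have h1 := hreach i j hi
    rw [← heq, inner_add_right, real_inner_smul_right, real_inner_smul_right] at h1
    have h2 := mul_le_mul_of_nonneg_left (le_max_left (inner ℝ (a i) (q (prev j)))
      (inner ℝ (a i) (q (next j)))) hs
    have h3 := mul_le_mul_of_nonneg_left (le_max_right (inner ℝ (a i) (q (prev j)))
      (inner ℝ (a i) (q (next j)))) ht
    have h4 := max_lt (hi _ (prev_ne j)) (hi _ (next_ne j))
    have h5 : b i < b i := calc
      b i ≤ (s + t) * max (inner ℝ (a i) (q (prev j))) (inner ℝ (a i) (q (next j))) := by linarith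
      _ < b i := by rw [hst, one_mul]; exact h4
    exact h5.false
  have hbend : ∀ j, bend q j ≠ 0 := fun j => bend_ne_zero hinj (hseg j)
  -- stationarity of the length at `q`
  have hcone : ∀ j, ∃ c : ι → ℝ, (∀ i, 0 ≤ c i) ∧
      (∀ i, 0 < c i → (∀ l, l ≠ j → inner ℝ (a i) (q l) < b i) ∧ inner ℝ (a i) (q j) = b i) ∧
      bend q j = ∑ i, c i • a i := by
    intro j
    -- the constraints that depend on the vertex `j` alone and hold there with equality
    set D : Finset ι := Finset.univ.filter fun i =>
      (∀ l, l ≠ j → inner ℝ (a i) (q l) < b i) ∧ inner ℝ (a i) (q j) = b i with hD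
    obtain ⟨i₀, hi₀⟩ := hpriv (next j)
    have hi₀D : i₀ ∉ D := fun h =>
      (hi₀ j (next_ne j).symm).ne (Finset.mem_filter.mp h).2.2
    obtain ⟨c, hc0, hcD, hc⟩ := exists_nonneg_combination (v := bend q j)
      (linearIndepOn_of_pairwise_inner_neg hS.pairwise_inner_neg hi₀D) fun d hd => by
        have hev : ∀ᶠ ε in 𝓝[>] (0 : ℝ), ∀ i, (∃ l, l ≠ j ∧ b i ≤ inner ℝ (a i) (q l)) ∨
            b i ≤ inner ℝ (a i) (q j + ε • d) := by
          refine eventually_all.mpr fun i => ?_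
          by_cases h1 : ∃ l, l ≠ j ∧ b i ≤ inner ℝ (a i) (q l)
          · exact Eventually.of_forall fun ε => Or.inl h1
          · push Not at h1
            rcases (hreach i j h1).eq_or_lt with h2 | h2
            · filter_upwards [self_mem_nhdsWithin] with ε hε
              right
              rw [inner_add_right, real_inner_smul_right, ← h2]
              have := mul_nonneg (le_of_lt (show (0 : ℝ) < ε from hε))
                (hd i (Finset.mem_filter.mpr ⟨Finset.mem_univ i, h1, h2.symm⟩))
              linarith
            · have h3 := eventually_inner_add_smul_lt (a := -a i) (x := q j) (β := -b i)
                (by rw [inner_neg_left]; linarith) d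
              filter_upwards [h3.filter_mono nhdsWithin_le_nhds] with ε hε
              right
              rw [inner_neg_left] at hε
              linarith
        refine inner_nonneg_of_eventually_le (sub_ne_zero.mpr fun h => prev_ne j (hinj h).symm)
          (sub_ne_zero.mpr fun h => next_ne j (hinj h)) (hev.mono fun ε hε => ?_)
        have := hmin _ (ReachesAll.snoc_cutAt hε)
        rw [length_snoc, length_eq_pathLength_cutAt_add q j, cutAt_zero, cutAt_last] at this
        linarith
    refine ⟨c, hc0, fun i hi => ?_, hc⟩
    by_contra h
    exact hi.ne' (hcD i fun h2 => h (Finset.mem_filter.mp h2).2)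
  choose c hc0 hcD hc using hcone
  have hpos := hS.exists_pos_coeff hc0 hc (hbend 0)
  -- since all normals occur, each half-space is touched by one vertex and missed by all others
  have hle : ∀ l i, inner ℝ (a i) (q l) ≤ b i := by
    intro l i
    obtain ⟨j, hj⟩ := hpos i
    rcases eq_or_ne l j with rfl | hl
    exacts [(hcD l i hj).2.le, ((hcD j i hj).1 l hl).le]
  have hmem : ∀ l, q l ∈ P := fun l => by rw [hS.eq_setOf]; exact hle l
  refine ⟨by omega, hinj, fun j => ?_, fun j => ?_, hseg⟩
  · rw [hS.isClosed.frontier_eq]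
    refine ⟨hmem j, fun hint => ?_⟩
    obtain ⟨i, hi⟩ := hpriv j
    exact (inner_lt_of_mem_interior hS.eq_setOf hint (hS.ne_zero i)).not_ge (hreach i j hi)
  · refine ⟨{x | inner ℝ (bend q j) x = inner ℝ (bend q j) (q j)},
      ⟨bend q j, _, hbend j, rfl, fun x hx => ?_, q j, hmem j, rfl⟩, rfl, fun x hx => ?_⟩
    · rw [hc j, sum_inner, sum_inner]
      refine Finset.sum_le_sum fun i _ => ?_
      rw [real_inner_smul_left, real_inner_smul_left]
      rcases (hc0 j i).eq_or_lt with h | h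
      · rw [← h, zero_mul, zero_mul]
      · rw [(hcD j i h).2]
        rw [hS.eq_setOf] at hx
        exact mul_le_mul_of_nonneg_left (hx i) h.le
    · refine norm_add_norm_le_of_inner_eq_zero (p := q j) ?_
      change inner ℝ (bend q j) (x - q j) = 0
      rw [inner_sub_right, show inner ℝ (bend q j) x = _ from hx, sub_self]

/-- Some billiard trajectory is no longer than a given polygon reaching all half-spaces: by
induction on the number of vertices, either a shortest such polygon is a trajectory or it can do
with one vertex less. -/
theorem IsObtuseSimplex.exists_trajectory_length_le (hS : IsObtuseSimplex P a b) {k : ℕ}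
    {q : Fin (k + 1) → EuclideanSpace ℝ (Fin n)} (hq : ReachesAll a b q) :
    ∃ (m : ℕ) (r : Fin m → EuclideanSpace ℝ (Fin n)),
      IsClosedBilliardTrajectory P r ∧ length r ≤ length q := by
  induction k with
  | zero =>
    obtain ⟨i, hi⟩ := hS.exists_inner_lt (q 0)
    obtain ⟨j, hj⟩ := hq i
    rw [Fin.fin_one_eq_zero j] at hj
    exact absurd hj (not_le.mpr hi)
  | succ k ih =>
    obtain ⟨r, hr, hmin⟩ := hS.exists_shortest hq
    by_cases hcut : ∃ j, ReachesAll a b (cutAt r j)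
    · obtain ⟨j, hj⟩ := hcut
      obtain ⟨m, s, hs, hsl⟩ := ih hj
      exact ⟨m, s, hs, hsl.trans ((length_cutAt_le r j).trans (hmin q hq))⟩
    · push Not at hcut
      exact ⟨_, r, hS.isClosedBilliardTrajectory_of_shortest hr hmin hcut, hmin q hq⟩

end Reaching

/-! ### Shortest billiard trajectories in simplices with acute dihedral angles -/

section Shortest

section Splitting

variable {F ι : Type*} [NormedAddCommGroup F] [InnerProductSpace ℝ F] [FiniteDimensional ℝ F]
  [Fintype ι]

/-- The improving splitting when the bend is steep with respect to the facet `i`. The difference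
of the two displacements is `q = -v - c i • a i`, for which the first order gain is `‖q‖ ^ 2`, and
the last hypothesis says that `‖q‖` exceeds one. -/
theorem exists_splitting_of_pos {a : ι → F} {D : Finset ι} (hD : LinearIndepOn ℝ a (D : Set ι))
    {v w : F} (hv : ‖v‖ = 1) {c : ι → ℝ} (hcD : ∀ i ∉ D, c i = 0)
    (hvw : w + v = -∑ i, c i • a i) {i : ι} (hi : i ∈ D) (hci : 0 < c i)
    (hpos : 0 < 2 * inner ℝ v (a i) + c i * inner ℝ (a i) (a i)) :
    ∃ x y, (∀ l ∈ D, 0 ≤ inner ℝ (a l) x ∨ 0 ≤ inner ℝ (a l) y) ∧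
      ‖x - y‖ < inner ℝ w x + inner ℝ v y := by
  classical
  set q : F := -v - c i • a i with hq
  obtain ⟨x, hx⟩ := exists_inner_eq_of_linearIndepOn hD
    (fun l => if l = i then inner ℝ (a i) q else 0)
  have hxi : inner ℝ (a i) x = inner ℝ (a i) q := by rw [hx i hi, if_pos rfl]
  refine ⟨x, x - q, fun l hl => ?_, ?_⟩
  · rcases eq_or_ne l i with rfl | hli
    · right
      rw [inner_sub_right, hxi, sub_self]
    · left
      rw [hx l hl, if_neg hli]
  · have hwx : inner ℝ w x = -inner ℝ v x - c i * inner ℝ (a i) q := by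
      have h1 : inner ℝ (∑ l, c l • a l) x = c i * inner ℝ (a i) q := by
        rw [sum_inner, Finset.sum_eq_single i]
        · rw [real_inner_smul_left, hxi]
        · intro l _ hli
          rw [real_inner_smul_left]
          by_cases hl : l ∈ D
          · rw [hx l hl, if_neg hli, mul_zero]
          · rw [hcD l hl, zero_mul]
        · simp
      rw [eq_sub_of_add_eq hvw, inner_sub_left, inner_neg_left, h1]
      ring
    have hsum : inner ℝ w x + inner ℝ v (x - q) = ‖q‖ ^ 2 := by
      have h2 : inner ℝ q q = -inner ℝ v q - c i * inner ℝ (a i) q := by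
        nth_rewrite 1 [hq]
        rw [inner_sub_left, inner_neg_left, real_inner_smul_left]
      rw [← real_inner_self_eq_norm_sq, h2, hwx, inner_sub_right v x q]
      ring
    have hqn : ‖q‖ ^ 2 = 1 + c i * (2 * inner ℝ v (a i) + c i * inner ℝ (a i) (a i)) := by
      rw [← real_inner_self_eq_norm_sq, hq, inner_sub_left, inner_sub_right, inner_sub_right,
        inner_neg_neg, inner_neg_left, inner_neg_right, real_inner_smul_left, real_inner_smul_left,
        real_inner_smul_right, real_inner_smul_right, real_inner_self_eq_norm_sq v, hv,
        real_inner_comm v (a i)]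
      ring
    have h1 : 1 < ‖q‖ ^ 2 := by
      rw [hqn]
      linarith [mul_pos hci hpos]
    rw [hsum, sub_sub_cancel]
    nlinarith [norm_nonneg q]

/-- If a polygon bends at a vertex on several facets, that vertex can be split in two
neighbouring vertices which together still reach all these facets, while the length decreases to
first order. Here `w` and `v` are the unit directions from the vertex to its two neighbours. -/
theorem exists_splitting {a : ι → F} (ha : Pairwise fun i j => inner ℝ (a i) (a j) < 0)
    {D : Finset ι} {i₀ : ι} (hi₀ : i₀ ∉ D) {v w : F} (hv : ‖v‖ = 1) (hw : ‖w‖ = 1) {c : ι → ℝ}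
    (hc : ∀ i, 0 ≤ c i) (hcD : ∀ i ∉ D, c i = 0) (hvw : w + v = -∑ i, c i • a i) {i k : ι}
    (hi : i ∈ D) (hci : 0 < c i) (hki : k ≠ i) (hck : 0 < c k) :
    ∃ x y, (∀ l ∈ D, 0 ≤ inner ℝ (a l) x ∨ 0 ≤ inner ℝ (a l) y) ∧
      ‖x - y‖ < inner ℝ w x + inner ℝ v y := by
  classical
  have hD := linearIndepOn_of_pairwise_inner_neg ha hi₀
  have hsum : inner ℝ w (a i) + inner ℝ v (a i) + c i * inner ℝ (a i) (a i)
      = -∑ l ∈ Finset.univ.erase i, c l * inner ℝ (a l) (a i) := by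
    rw [← inner_add_left, hvw, inner_neg_left, sum_inner,
      ← Finset.add_sum_erase _ _ (Finset.mem_univ i), real_inner_smul_left]
    simp only [real_inner_smul_left]
    ring
  have hneg : ∑ l ∈ Finset.univ.erase i, c l * inner ℝ (a l) (a i) < 0 := by
    refine Finset.sum_neg' (fun l hl => ?_) ⟨k, by simp [hki], mul_neg_of_pos_of_neg hck (ha hki)⟩
    exact mul_nonpos_of_nonneg_of_nonpos (hc l) (ha (Finset.ne_of_mem_erase hl)).le
  -- the sum of the two conditions `0 < 2 * ⟪v, a i⟫ + c i * ⟪a i, a i⟫` and the same for `w` holds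
  -- because the normals form obtuse angles, so one of the two orders of splitting is improving
  rcases lt_or_ge 0 (2 * inner ℝ v (a i) + c i * inner ℝ (a i) (a i)) with h | h
  · exact exists_splitting_of_pos hD hv hcD hvw hi hci h
  · rw [add_comm] at hvw
    obtain ⟨x, y, hxy, hlt⟩ := exists_splitting_of_pos hD hw hcD hvw hi hci (by linarith)
    refine ⟨y, x, fun l hl => (hxy l hl).symm, ?_⟩
    rwa [norm_sub_rev, add_comm]

end Splitting

variable {n : ℕ} {ι : Type} {P : Set (EuclideanSpace ℝ (Fin n))}
  {a : ι → EuclideanSpace ℝ (Fin n)} {b : ι → ℝ}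

/-- The reflection law: the bend of a billiard trajectory is an outer normal at its vertex. -/
theorem IsClosedBilliardTrajectory.inner_bend_nonpos {k : ℕ}
    {p : Fin (k + 2) → EuclideanSpace ℝ (Fin n)} (hp : IsClosedBilliardTrajectory P p)
    (hpP : ∀ j, p j ∈ P) (j : Fin (k + 2)) {y : EuclideanSpace ℝ (Fin n)} (hy : y ∈ P) :
    inner ℝ (bend p j) (y - p j) ≤ 0 := by
  obtain ⟨-, hinj, -, hrule, -⟩ := hp
  obtain ⟨H, ⟨u, γ, hu, rfl, hPu, -⟩, hjH, hmin⟩ := hrule j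
  have hju : inner ℝ u (p j) = γ := hjH
  have hnonneg : ∀ d, inner ℝ u d = 0 → 0 ≤ inner ℝ (bend p j) d := fun d hd =>
    inner_nonneg_of_eventually_le (sub_ne_zero.mpr fun h => prev_ne j (hinj h).symm)
      (sub_ne_zero.mpr fun h => next_ne j (hinj h)) (Eventually.of_forall fun ε => hmin _ (by
        change inner ℝ u _ = γ
        rw [inner_add_right, real_inner_smul_right, hd, hju, mul_zero, add_zero]))
  have hmem : bend p j ∈ (Submodule.span ℝ {u})ᗮᗮ := by
    rw [Submodule.mem_orthogonal]
    intro d hd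
    rw [Submodule.mem_orthogonal_singleton_iff_inner_right] at hd
    have h1 := hnonneg d hd
    have h2 := hnonneg (-d) (by rw [inner_neg_right, hd, neg_zero])
    rw [inner_neg_right] at h2
    rw [real_inner_comm]
    linarith
  rw [Submodule.orthogonal_orthogonal] at hmem
  obtain ⟨ν, hν⟩ := Submodule.mem_span_singleton.mp hmem
  have h1 : 0 ≤ inner ℝ (bend p j) u := by
    have h2 := hPu _ (hpP (prev j))
    have h3 := hPu _ (hpP (next j))
    rw [bend, inner_sub_left, real_inner_smul_left, real_inner_smul_left, inner_sub_left,
      inner_sub_left, real_inner_comm, real_inner_comm u, real_inner_comm u, hju]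
    have h4 := mul_nonneg (inv_nonneg.mpr (norm_nonneg (p j - p (prev j)))) (sub_nonneg.mpr h2)
    have h5 := mul_nonneg (inv_nonneg.mpr (norm_nonneg (p (next j) - p j))) (sub_nonneg.mpr h3)
    linarith
  rw [← hν, real_inner_smul_left] at h1 ⊢
  have h2 : 0 ≤ ν := nonneg_of_mul_nonneg_left h1 (real_inner_self_pos.mpr hu)
  refine mul_nonpos_of_nonneg_of_nonpos h2 ?_
  rw [inner_sub_right, hju]
  linarith [hPu y hy]

variable [Fintype ι]

/-- The normal cone of a simplex at one of its points is spanned by the active facet normals. -/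
theorem IsObtuseSimplex.exists_nonneg_combination_of_normal (hS : IsObtuseSimplex P a b)
    {x v : EuclideanSpace ℝ (Fin n)} (hx : x ∈ P) (hv : ∀ y ∈ P, inner ℝ v (y - x) ≤ 0) :
    ∃ c : ι → ℝ, (∀ i, 0 ≤ c i) ∧ (∀ i, 0 < c i → inner ℝ (a i) x = b i) ∧
      v = ∑ i, c i • a i := by
  classical
  have hx' : ∀ i, inner ℝ (a i) x ≤ b i := by rwa [hS.eq_setOf] at hx
  obtain ⟨i₀, hi₀⟩ := hS.exists_inner_lt x
  obtain ⟨c, hc0, hcD, hc⟩ := exists_nonneg_combination (v := v)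
    (D := Finset.univ.filter fun i => inner ℝ (a i) x = b i)
    (linearIndepOn_of_pairwise_inner_neg hS.pairwise_inner_neg (i₀ := i₀) (by simp [hi₀.ne]))
    fun d hd => by
      have hev : ∀ᶠ ε in 𝓝[>] (0 : ℝ), ∀ i, inner ℝ (a i) (x + ε • -d) ≤ b i := by
        refine eventually_all.mpr fun i => ?_
        rcases (hx' i).eq_or_lt with h | h
        · filter_upwards [self_mem_nhdsWithin] with ε hε
          rw [inner_add_right, real_inner_smul_right, inner_neg_right, h]
          have := mul_nonneg (le_of_lt (show (0 : ℝ) < ε from hε)) (hd i (by simp [h]))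
          linarith
        · exact ((eventually_inner_add_smul_lt h (-d)).filter_mono nhdsWithin_le_nhds).mono
            fun ε h => h.le
      obtain ⟨ε, h1, h2⟩ := (hev.and self_mem_nhdsWithin).exists
      have h3 := hv (x + ε • -d) (by rw [hS.eq_setOf]; exact h1)
      rw [add_sub_cancel_left, real_inner_smul_right, inner_neg_right] at h3
      have h4 : (0 : ℝ) < ε := h2
      by_contra! h5
      nlinarith
  refine ⟨c, hc0, fun i hi => ?_, hc⟩
  by_contra h
  exact hi.ne' (hcD i (by simp [h]))

theorem IsObtuseSimplex.length_le_of_reachesAll (hS : IsObtuseSimplex P a b) {m k : ℕ}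
    {p : Fin m → EuclideanSpace ℝ (Fin n)} (hp : IsLengthMinimizing P p)
    {q : Fin (k + 1) → EuclideanSpace ℝ (Fin n)} (hq : ReachesAll a b q) :
    length p ≤ length q := by
  obtain ⟨l, r, hr, hle⟩ := hS.exists_trajectory_length_le hq
  exact (hp.2 l r hr).trans hle

/-- The bends of a billiard trajectory are nonnegative combinations of the normals of the facets
through its vertices, and every facet takes part. -/
theorem IsObtuseSimplex.exists_bend_coeff (hS : IsObtuseSimplex P a b) {k : ℕ}
    {p : Fin (k + 2) → EuclideanSpace ℝ (Fin n)} (hp : IsClosedBilliardTrajectory P p) :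
    ∃ c : Fin (k + 2) → ι → ℝ, (∀ j i, 0 ≤ c j i) ∧
      (∀ j i, 0 < c j i → inner ℝ (a i) (p j) = b i) ∧ (∀ j, bend p j = ∑ i, c j i • a i) ∧
      (∀ i, ∃ j, 0 < c j i) ∧ ∀ j, ∃ i, 0 < c j i := by
  have hpP : ∀ j, p j ∈ P := fun j => hS.isClosed.frontier_subset (hp.2.2.1 j)
  have h := fun j => hS.exists_nonneg_combination_of_normal (hpP j)
    (fun y hy => hp.inner_bend_nonpos hpP j hy)
  choose c hc0 hcact hc using h
  refine ⟨c, hc0, hcact, hc, hS.exists_pos_coeff hc0 hc (bend_ne_zero hp.2.1 (hp.2.2.2.2 0)),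
    fun j => ?_⟩
  by_contra! h
  refine bend_ne_zero hp.2.1 (hp.2.2.2.2 j) ?_
  rw [hc]
  exact Finset.sum_eq_zero fun i _ => by rw [le_antisymm (h i) (hc0 j i), zero_smul]

/-- The vertices of a shortest billiard trajectory lie on one facet each, since a vertex on several
facets could be split in two neighbouring vertices to obtain a shorter closed polygon that still
meets all facets. -/
theorem IsObtuseSimplex.eq_of_active (hS : IsObtuseSimplex P a b) {k : ℕ}
    {p : Fin (k + 2) → EuclideanSpace ℝ (Fin n)} (hp : IsLengthMinimizing P p) {j : Fin (k + 2)}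
    {i i' : ι} (hi : inner ℝ (a i) (p j) = b i) (hi' : inner ℝ (a i') (p j) = b i') : i = i' := by
  classical
  by_contra hne
  obtain ⟨c, hc0, hcact, hc, hpos, hne0⟩ := hS.exists_bend_coeff hp.1
  have hinj := hp.1.2.1
  have hpP : ∀ j i, inner ℝ (a i) (p j) ≤ b i := fun j => by
    have := hS.isClosed.frontier_subset (hp.1.2.2.1 j)
    rwa [hS.eq_setOf] at this
  set A := p j - p (prev j) with hA
  set B := p (next j) - p j with hB
  have hA0 : A ≠ 0 := sub_ne_zero.mpr fun h => prev_ne j (hinj h).symm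
  have hB0 : B ≠ 0 := sub_ne_zero.mpr fun h => next_ne j (hinj h)
  have hbend : bend p j = ‖A‖⁻¹ • A - ‖B‖⁻¹ • B := rfl
  obtain ⟨k₀, hk₀⟩ := hne0 j
  -- the normal of every active facet has a positive coefficient in the bend
  have hactive : ∀ i, inner ℝ (a i) (p j) = b i → 0 < c j i := by
    intro i hi
    by_contra! h
    have hci : c j i = 0 := le_antisymm h (hc0 j i)
    have hneg : inner ℝ (bend p j) (a i) < 0 := by
      rw [hc, sum_inner]
      refine Finset.sum_neg' (fun l _ => ?_) ⟨k₀, Finset.mem_univ _, ?_⟩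
      · rw [real_inner_smul_left]
        rcases eq_or_ne l i with rfl | hl
        · rw [hci, zero_mul]
        · exact mul_nonpos_of_nonneg_of_nonpos (hc0 j l) (hS.pairwise_inner_neg hl).le
      · rw [real_inner_smul_left]
        have hk : k₀ ≠ i := fun h => by rw [h, hci] at hk₀; exact hk₀.false
        exact mul_neg_of_pos_of_neg hk₀ (hS.pairwise_inner_neg hk)
    have h1 : 0 ≤ inner ℝ A (a i) := by
      rw [real_inner_comm, hA, inner_sub_right, hi]; linarith [hpP (prev j) i]
    have h2 : inner ℝ B (a i) ≤ 0 := by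
      rw [real_inner_comm, hB, inner_sub_right, hi]; linarith [hpP (next j) i]
    rw [hbend, inner_sub_left, real_inner_smul_left, real_inner_smul_left] at hneg
    have h3 := mul_nonneg (inv_nonneg.mpr (norm_nonneg A)) h1
    have h4 := mul_nonpos_of_nonneg_of_nonpos (inv_nonneg.mpr (norm_nonneg B)) h2
    linarith
  obtain ⟨i₀, hi₀⟩ := hS.exists_inner_lt (p j)
  obtain ⟨x, y, hxy, hlt⟩ := exists_splitting hS.pairwise_inner_neg
    (D := Finset.univ.filter fun i => inner ℝ (a i) (p j) = b i) (i₀ := i₀) (by simp [hi₀.ne])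
    (v := ‖B‖⁻¹ • B) (w := -(‖A‖⁻¹ • A)) (norm_smul_inv_norm hB0)
    (by rw [norm_neg]; exact norm_smul_inv_norm hA0) (hc0 j) (fun i hi => by
      by_contra h
      exact hi (by simpa using hcact j i (lt_of_le_of_ne (hc0 j i) (Ne.symm h))))
    (by rw [← hc, hbend]; abel) (i := i) (k := i') (by simpa using hi) (hactive i hi)
    (Ne.symm hne) (hactive i' hi')
  obtain ⟨ε, hε, hε0⟩ := ((eventually_mul_add_sq_mul_neg
    (s := ‖x - y‖ - (inner ℝ (-(‖A‖⁻¹ • A)) x + inner ℝ (‖B‖⁻¹ • B) y)) (by linarith)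
    (‖x‖ ^ 2 * (2 * ‖A‖)⁻¹ + ‖y‖ ^ 2 * (2 * ‖B‖)⁻¹)).and self_mem_nhdsWithin).exists
  have hε0' : (0 : ℝ) < ε := hε0
  set q : Fin (k + 3) → EuclideanSpace ℝ (Fin n) :=
    Fin.snoc (Fin.snoc (cutAt p j) (p j + ε • x) : Fin (k + 2) → EuclideanSpace ℝ (Fin n))
      (p j + ε • y) with hq
  have hreach : ReachesAll a b q := by
    intro i
    by_cases h : inner ℝ (a i) (p j) = b i
    · rcases hxy i (by simpa using h) with h1 | h1
      · refine ⟨(Fin.last _).castSucc, ?_⟩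
        rw [hq, Fin.snoc_castSucc, Fin.snoc_last, inner_add_right, real_inner_smul_right, h]
        linarith [mul_nonneg hε0'.le h1]
      · refine ⟨Fin.last _, ?_⟩
        rw [hq, Fin.snoc_last, inner_add_right, real_inner_smul_right, h]
        linarith [mul_nonneg hε0'.le h1]
    · obtain ⟨l, hl⟩ := hpos i
      have hlj : l ≠ j := fun hlj => h (hlj ▸ hcact l i hl)
      obtain ⟨t, ht⟩ := exists_cutAt_eq p hlj
      exact ⟨t.castSucc.castSucc, by
        rw [hq, Fin.snoc_castSucc, Fin.snoc_castSucc, ht, hcact l i hl]⟩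
  have hlen := hS.length_le_of_reachesAll hp hreach
  rw [hq, length_snoc, pathLength_snoc, Fin.snoc_last, ← Fin.castSucc_zero, Fin.snoc_castSucc,
    cutAt_zero, cutAt_last, length_eq_pathLength_cutAt_add p j] at hlen
  have h1 := norm_add_le_norm_add_inner hA0 (ε • x)
  have h2 := norm_add_le_norm_add_inner hB0 (-(ε • y))
  rw [inner_neg_right, norm_neg] at h2
  rw [norm_smul, mul_pow, Real.norm_eq_abs, sq_abs, real_inner_smul_right] at h1 h2
  have h3 : ‖p j + ε • y - (p j + ε • x)‖ = ε * ‖x - y‖ := by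
    rw [add_sub_add_left_eq_sub, ← smul_sub, norm_smul, norm_sub_rev, Real.norm_of_nonneg hε0'.le]
  rw [h3, show p j + ε • x - p (prev j) = A + ε • x by rw [hA]; abel,
    show p (next j) - (p j + ε • y) = B + -(ε • y) by rw [hB]; abel] at hlen
  rw [inner_neg_left] at hε
  linarith

theorem IsObtuseSimplex.isRegular (hS : IsObtuseSimplex P a b) {k : ℕ}
    {p : Fin (k + 2) → EuclideanSpace ℝ (Fin n)} (hp : IsLengthMinimizing P p) :
    IsRegular P p := by
  intro j
  have hj := hp.1.2.2.1 j
  obtain ⟨H, hH, hjH, -⟩ := hp.1.2.2.2.1 j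
  obtain ⟨c, -, hcact, -, -, hne0⟩ := hS.exists_bend_coeff hp.1
  obtain ⟨i, hi⟩ := (hne0 j).imp fun i h => hcact j i h
  have huniq : ∀ H, IsSupportingHyperplane P H → p j ∈ H → H = {x | inner ℝ (a i) x = b i} := by
    rintro _ ⟨u, γ, hu, rfl, hPu, -⟩ hju
    have hju' : inner ℝ u (p j) = γ := hju
    obtain ⟨c, hc0, hcact, hc⟩ := hS.exists_nonneg_combination_of_normal
      (hS.isClosed.frontier_subset hj) (v := u) fun y hy => by
        rw [inner_sub_right, hju']; linarith [hPu y hy]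
    have huc : u = c i • a i := by
      rw [hc]
      refine Finset.sum_eq_single i (fun l _ hl => ?_) (by simp)
      rw [smul_eq_zero]
      by_contra! h
      exact hl (hS.eq_of_active hp (hcact l ((hc0 l).lt_of_ne' h.1)) hi)
    have hci : c i ≠ 0 := fun h => hu (by rw [huc, h, zero_smul])
    ext x
    change inner ℝ u x = γ ↔ inner ℝ (a i) x = b i
    rw [← hju', huc, real_inner_smul_left, real_inner_smul_left, hi, mul_right_inj' hci]
  exact ⟨hj, H, ⟨hH, hjH⟩, fun H' h => (huniq H' h.1 h.2).trans (huniq H hH hjH).symm⟩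

/-- No vertex can be omitted from a shortest trajectory without missing a facet, and no vertex lies
on two facets, so there are as many vertices as facets. -/
theorem IsObtuseSimplex.eq_add_one (hS : IsObtuseSimplex P a b) {k : ℕ}
    {p : Fin (k + 2) → EuclideanSpace ℝ (Fin n)} (hp : IsLengthMinimizing P p) :
    k + 2 = n + 1 := by
  obtain ⟨c, hc0, hcact, hc, hpos, -⟩ := hS.exists_bend_coeff hp.1
  choose f hf using hpos
  have hact : ∀ i, inner ℝ (a i) (p (f i)) = b i := fun i => hcact _ i (hf i)
  have hinj : Function.Injective f := fun i i' h =>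
    hS.eq_of_active hp (hact i) (h ▸ hact i')
  have hsurj : Function.Surjective f := by
    intro j
    by_contra! h
    have hreach : ReachesAll a b (cutAt p j) := by
      intro i
      obtain ⟨t, ht⟩ := exists_cutAt_eq p (h i)
      exact ⟨t, by rw [ht, hact]⟩
    exact (length_cutAt_lt p (hp.1.2.2.2.2 j)).not_ge (hS.length_le_of_reachesAll hp hreach)
  rw [← hS.card_eq, Fintype.card_of_bijective ⟨hinj, hsurj⟩, Fintype.card_fin]

/-- The bends are differences of vertices up to scaling and, at a shortest trajectory, multiples of
single facet normals; hence the vertices span all directions. -/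
theorem IsObtuseSimplex.isMaximallySpanning (hS : IsObtuseSimplex P a b) {k : ℕ}
    {p : Fin (k + 2) → EuclideanSpace ℝ (Fin n)} (hp : IsLengthMinimizing P p) :
    IsMaximallySpanning p := by
  obtain ⟨c, hc0, hcact, hc, hpos, -⟩ := hS.exists_bend_coeff hp.1
  have hbend : ∀ j, bend p j ∈ vectorSpan ℝ (Set.range p) := fun j =>
    Submodule.sub_mem _
      (Submodule.smul_mem _ _ (vsub_mem_vectorSpan ℝ ⟨j, rfl⟩ ⟨prev j, rfl⟩))
      (Submodule.smul_mem _ _ (vsub_mem_vectorSpan ℝ ⟨next j, rfl⟩ ⟨j, rfl⟩))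
  have htop : vectorSpan ℝ (Set.range p) = ⊤ := by
    rw [eq_top_iff, ← hS.span_eq_top, Submodule.span_le]
    rintro _ ⟨i, rfl⟩
    obtain ⟨j, hj⟩ := hpos i
    have h := hbend j
    rw [hc, Finset.sum_eq_single i (fun l _ hl => ?_) (by simp)] at h
    · exact (Submodule.smul_mem_iff _ hj.ne').mp h
    · rw [smul_eq_zero]
      by_contra! h
      exact hl (hS.eq_of_active hp (hcact j l ((hc0 j l).lt_of_ne' h.1)) (hcact j i hj))
  rw [IsMaximallySpanning, affineDim, ← direction_affineSpan, affineSpan_convexHull,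
    direction_affineSpan, htop, finrank_top, finrank_euclideanSpace_fin, hS.eq_add_one hp]

end Shortest

end Billiard


theorem theorem1p2 (n : ℕ) (P : Set (EuclideanSpace ℝ (Fin n)))
    (hP : Billiard.IsConvexPolytope P) (hacute : Billiard.IsAcute P)
    (m : ℕ) (p : Fin m → EuclideanSpace ℝ (Fin n))
    (hp : Billiard.IsLengthMinimizing P p) :
    Billiard.IsMaximallySpanning p ∧ Billiard.IsRegular P p ∧ m = n + 1 := by
  obtain ⟨k, rfl⟩ : ∃ k, m = k + 2 := ⟨m - 2, by have := hp.1.1; omega⟩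
  have hn : 0 < n := by
    rcases Nat.eq_zero_or_pos n with rfl | hn
    · exact absurd (hp.1.2.1 (Subsingleton.elim (p 0) (p 1))) (by simp)
    · exact hn
  obtain ⟨ι, _, a, b, hS⟩ := hacute.exists_isObtuseSimplex hn hP
  exact ⟨hS.isMaximallySpanning hp, hS.isRegular hp, hS.eq_add_one hp⟩
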